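/- For $x\in\mathbb Q$ write $e(x)=e^{2\pi i x}$, and for $u,v,w\in\mathbb Q$ with $u+v+w\in\mathbb Z$ let $D(u,v,w)\in\mathrm{SU}(3)$ be the diagonal matrix $\operatorname{Diag}(e(u),e(v),e(w))$. Let $\mu_3=\{\zeta\cdot 1:\zeta^3=1\}\subset\mathrm{SU}(3)$, and let $\phi$ be a synonym for the number $3$. **Proposition.** Let $H$ be a finite abelian subgroup of $\mathrm{SU}(3)$ which contains $\mu_3$ and satisfies the restricted rationality condition: $|\operatorname{Trace}(A)|^2\in\mathbb Z$ for all $A\in H$. Then $H$ is conjugate in $\mathrm{SU}(3)$ to exactly one of the following $22$ groups of diagonal matrices. The cyclic groups - $A(1,1\phi)=\langle D(\tfrac13,\tfrac13,\tfrac13)\rangle$ - $A(1,2\phi)=\langle D(\tfrac13,\tfrac56,\tfrac56)\rangle$ - $A(1,3\phi)=\langle D(\tfrac19,\tfrac49,\tfrac49)\rangle$ - $A(1,4\phi)_1=\langle D(\tfrac16,\tfrac5{12},\tfrac5{12})\rangle$ - $A(1,4\phi)_2=\langle D(\tfrac13,\tfrac1{12},\tfrac7{12})\rangle$ - $A(1,6\phi)_1=\langle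 D(\tfrac19,\tfrac{17}{18},\tfrac{17}{18})\rangle$ - $A(1,6\phi)_2=\langle D(\tfrac1{18},\tfrac29,\tfrac{13}{18})\rangle$ - $A(1,7\phi)=\langle D(\tfrac1{21},\tfrac{16}{21},\tfrac4{21})\rangle$ - $A(1,8\phi)_1=\langle D(\tfrac16,\tfrac1{24},\tfrac{19}{24})\rangle$ - $A(1,8\phi)_2=\langle D(\tfrac1{12},\tfrac5{24},\tfrac{17}{24})\rangle$ - $A(1,12\phi)=\langle D(\tfrac19,\tfrac7{36},\tfrac{25}{36})\rangle$ and the groups - $A(2,2\phi)=\langle D(0,\tfrac12,\tfrac12),D(\tfrac16,\tfrac16,\tfrac23)\rangle$ - $A(2,4\phi)=\langle D(\tfrac12,0,\tfrac12),D(\tfrac16,\tfrac5{12},\tfrac5{12})\rangle$ - $A(2,6\phi)=\langle D(\tfrac12,0,\tfrac12),D(\tfrac19,\tfrac{17}{18},\tfrac{17}{18})\rangle$ - $A(3,1\phi)=\langle D(\tfrac13,0,\tfrac23),D(\tfrac13,\tfrac13,\tfrac13)\rangle$ - $A(3,2\phi)=\langle D(\tfrac13,0,\tfrac23),D(\tfrac23,\tfrac16,\tfrac16)\rangle$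 - $A(3,3\phi)=\langle D(0,\tfrac13,\tfrac23),D(\tfrac19,\tfrac19,\tfrac79)\rangle$ - $A(3,4\phi)=\langle D(0,\tfrac13,\tfrac23),D(\tfrac16,\tfrac5{12},\tfrac5{12})\rangle$ - $A(3,6\phi)=\langle D(0,\tfrac13,\tfrac23),D(\tfrac19,\tfrac5{18},\tfrac{11}{18})\rangle$ - $A(4,4\phi)=\langle D(0,\tfrac14,\tfrac34),D(\tfrac1{12},\tfrac1{12},\tfrac56)\rangle$ - $A(6,2\phi)=\langle D(\tfrac16,0,\tfrac56),D(\tfrac23,\tfrac16,\tfrac16)\rangle$ - $A(6,6\phi)=\langle D(0,\tfrac16,\tfrac56),D(\tfrac1{18},\tfrac1{18},\tfrac89)\rangle$ -/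

import Mathlib

noncomputable section

namespace FiniteSU3

/-- The group `SU(3)`. -/
abbrev SU3 : Type := Matrix.specialUnitaryGroup (Fin 3) ℂ

/-- `e(x) = exp(2πix)`, for rational `x`. -/
def e (x : ℚ) : ℂ := Complex.exp (2 * Real.pi * Complex.I * (x : ℂ))

lemma e_add (x y : ℚ) : e (x + y) = e x * e y := by
  rw [e, e, e, ← Complex.exp_add]
  push_cast
  ring_nf

lemma e_int (n : ℤ) : e (n : ℚ) = 1 := by
  rw [e, Complex.exp_eq_one_iff]
  exact ⟨n, by push_cast; ring⟩

lemma e_mul_star (x : ℚ) : e x * star (e x) = 1 := by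
  have h : star (e x) = e (-x) := by
    rw [e, e, Complex.star_def, ← Complex.exp_conj]
    congr 1
    simp only [map_mul, Complex.conj_ofReal, Complex.conj_I, map_ratCast, map_ofNat,
      Rat.cast_neg]
    ring
  rw [h, ← e_add, add_neg_cancel]
  simpa using e_int 0

/-- The diagonal matrix `D(u,v,w) = Diag(e(u), e(v), e(w))`, as an element of `SU(3)`;
the determinant is `1` because `u + v + w` is an integer. -/
def D (u v w : ℚ) (h : ∃ n : ℤ, u + v + w = n) : SU3 :=
  ⟨Matrix.diagonal ![e u, e v, e w], by
    rw [Matrix.mem_specialUnitaryGroup_iff, Matrix.mem_unitaryGroup_iff]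
    constructor
    · rw [Matrix.star_eq_conjTranspose, Matrix.diagonal_conjTranspose,
        Matrix.diagonal_mul_diagonal, ← Matrix.diagonal_one]
      congr 1
      funext i
      fin_cases i <;> simpa using e_mul_star _
    · obtain ⟨n, hn⟩ := h
      rw [Matrix.det_diagonal, Fin.prod_univ_three]
      simp only [Matrix.cons_val]
      rw [← e_add, ← e_add, hn, e_int]⟩

/-- `μ₃`, the group of scalar matrices `ζ · 1` with `ζ³ = 1`. -/
def mu3 : Subgroup SU3 where
  carrier := {A | ∃ ζ : ℂ, ζ ^ 3 = 1 ∧ (A : Matrix (Fin 3) (Fin 3) ℂ) = ζ • 1}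
  one_mem' := ⟨1, by norm_num, by simp⟩
  mul_mem' := by
    rintro A B ⟨x, hx, hA⟩ ⟨y, hy, hB⟩
    refine ⟨x * y, by rw [mul_pow, hx, hy, one_mul], ?_⟩
    rw [Submonoid.coe_mul, hA, hB, smul_mul_smul_comm, one_mul]
  inv_mem' := by
    rintro A ⟨x, hx, hA⟩
    refine ⟨star x, by rw [← star_pow, hx, star_one], ?_⟩
    rw [← Matrix.star_eq_inv, Matrix.specialUnitaryGroup.coe_star, hA, star_smul, star_one]

/-- The restricted rationality condition: `|Trace A|²` is an integer for all `A` in `H`. -/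
def RestrictedRationality (H : Subgroup SU3) : Prop :=
  ∀ A ∈ H, ∃ n : ℤ, ‖(A : Matrix (Fin 3) (Fin 3) ℂ).trace‖ ^ 2 = (n : ℝ)

/-- Two subgroups of `SU(3)` are conjugate. -/
def Conjugate (H K : Subgroup SU3) : Prop :=
  ∃ g : SU3, H.map (MulAut.conj g).toMonoidHom = K

/-- The 22 labels; `A_m_n` or `A_m_n_k` stands for `A(m,nφ)` or `A(m,nφ)ₖ`, where `φ = 3`. -/
inductive AbelianLabel : Type
  | A_1_1 | A_1_2 | A_1_3 | A_1_4_1 | A_1_4_2 | A_1_6_1 | A_1_6_2 | A_1_7 | A_1_8_1 | A_1_8_2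
  | A_1_12
  | A_2_2 | A_2_4 | A_2_6
  | A_3_1 | A_3_2 | A_3_3 | A_3_4 | A_3_6
  | A_4_4 | A_6_2 | A_6_6

/-- The 22 groups of diagonal matrices, by generators. -/
def abelianGroup : AbelianLabel → Subgroup SU3
  | .A_1_1 => Subgroup.closure {D (1/3) (1/3) (1/3) ⟨1, by norm_num⟩}
  | .A_1_2 => Subgroup.closure {D (1/3) (5/6) (5/6) ⟨2, by norm_num⟩}
  | .A_1_3 => Subgroup.closure {D (1/9) (4/9) (4/9) ⟨1, by norm_num⟩}
  | .A_1_4_1 => Subgroup.closure {D (1/6) (5/12) (5/12) ⟨1, by norm_num⟩}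
  | .A_1_4_2 => Subgroup.closure {D (1/3) (1/12) (7/12) ⟨1, by norm_num⟩}
  | .A_1_6_1 => Subgroup.closure {D (1/9) (17/18) (17/18) ⟨2, by norm_num⟩}
  | .A_1_6_2 => Subgroup.closure {D (1/18) (2/9) (13/18) ⟨1, by norm_num⟩}
  | .A_1_7 => Subgroup.closure {D (1/21) (16/21) (4/21) ⟨1, by norm_num⟩}
  | .A_1_8_1 => Subgroup.closure {D (1/6) (1/24) (19/24) ⟨1, by norm_num⟩}
  | .A_1_8_2 => Subgroup.closure {D (1/12) (5/24) (17/24) ⟨1, by norm_num⟩}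
  | .A_1_12 => Subgroup.closure {D (1/9) (7/36) (25/36) ⟨1, by norm_num⟩}
  | .A_2_2 => Subgroup.closure
      {D 0 (1/2) (1/2) ⟨1, by norm_num⟩, D (1/6) (1/6) (2/3) ⟨1, by norm_num⟩}
  | .A_2_4 => Subgroup.closure
      {D (1/2) 0 (1/2) ⟨1, by norm_num⟩, D (1/6) (5/12) (5/12) ⟨1, by norm_num⟩}
  | .A_2_6 => Subgroup.closure
      {D (1/2) 0 (1/2) ⟨1, by norm_num⟩, D (1/9) (17/18) (17/18) ⟨2, by norm_num⟩}
  | .A_3_1 => Subgroup.closure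
      {D (1/3) 0 (2/3) ⟨1, by norm_num⟩, D (1/3) (1/3) (1/3) ⟨1, by norm_num⟩}
  | .A_3_2 => Subgroup.closure
      {D (1/3) 0 (2/3) ⟨1, by norm_num⟩, D (2/3) (1/6) (1/6) ⟨1, by norm_num⟩}
  | .A_3_3 => Subgroup.closure
      {D 0 (1/3) (2/3) ⟨1, by norm_num⟩, D (1/9) (1/9) (7/9) ⟨1, by norm_num⟩}
  | .A_3_4 => Subgroup.closure
      {D 0 (1/3) (2/3) ⟨1, by norm_num⟩, D (1/6) (5/12) (5/12) ⟨1, by norm_num⟩}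
  | .A_3_6 => Subgroup.closure
      {D 0 (1/3) (2/3) ⟨1, by norm_num⟩, D (1/9) (5/18) (11/18) ⟨1, by norm_num⟩}
  | .A_4_4 => Subgroup.closure
      {D 0 (1/4) (3/4) ⟨1, by norm_num⟩, D (1/12) (1/12) (5/6) ⟨1, by norm_num⟩}
  | .A_6_2 => Subgroup.closure
      {D (1/6) 0 (5/6) ⟨1, by norm_num⟩, D (2/3) (1/6) (1/6) ⟨1, by norm_num⟩}
  | .A_6_6 => Subgroup.closure
      {D 0 (1/6) (5/6) ⟨1, by norm_num⟩, D (1/18) (1/18) (8/9) ⟨1, by norm_num⟩}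

end FiniteSU3

end

/-! A commutative subgroup of `SU(3)` can be diagonalised inside `SU(3)`. For a diagonal `A`,
`|Trace A|²` is 3 plus the sum of the six ratios of distinct eigenvalues. Since every power of `A`
also lies in `H`, all power sums of these ratios are integers, so the multiset of ratios is stable
under Galois conjugation. Hence a ratio of order `n` occurs with all its conjugates, `φ(n) ≤ 6`, and
`n` divides 2520.

As `H` contains `μ₃`, it is determined by its group `Λ` of exponents `(x, y)` of the two successive
eigenvalue ratios, where `2520 ℤ² ≤ Λ ≤ ℤ²`. Permuting the eigenvalues acts on such lattices. The
classification climbs from `2520 ℤ²`, the lattice of `A(1,1φ)`: if `Λ` contains a listed lattice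
properly, adjoining any further vector either produces a forbidden exponent or yields, up to a
permutation, a larger listed lattice (`step_check`, `exists_larger_lattice`). Indices over `2520 ℤ²`
are at most 36, so the climb ends with `Λ` itself listed.

For uniqueness, a conjugation between diagonal groups permutes the diagonal entries, so conjugate
listed groups have lattices embedding into each other by permutations; `embed_check` excludes this
for different labels. -/

/-! ### Power sums, Galois conjugation and orders of roots of unity -/

open Polynomial in
-- Power sums determine the sum of values of every polynomial; a polynomial vanishing at all the
-- other elements but not at `z` then reads off the multiplicity of `z`.
theorem Multiset.eq_of_forall_sum_map_pow_eq {K : Type*} [Field K] [CharZero K]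
    {s t : Multiset K}
    (h : ∀ k : ℕ, (s.map (· ^ k)).sum = (t.map (· ^ k)).sum) : s = t := by
  classical
  have heval : ∀ P : K[X], (s.map P.eval).sum = (t.map P.eval).sum := by
    intro P
    induction P using Polynomial.induction_on' with
    | add p q hp hq => simp [Polynomial.eval_add, Multiset.sum_map_add, hp, hq]
    | monomial n a => simp [Polynomial.eval_monomial, Multiset.sum_map_mul_left, h]
  ext z
  set P : K[X] := ∏ w ∈ (s + t).toFinset.erase z, (X - C w) with hP
  have hz : P.eval z ≠ 0 := by
    rw [hP, eval_prod, Finset.prod_ne_zero_iff]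
    intro w hw
    simpa [sub_eq_zero] using (Finset.ne_of_mem_erase hw).symm
  have hw : ∀ w ∈ (s + t).toFinset, w ≠ z → P.eval w = 0 := by
    intro w hw hne
    rw [hP, eval_prod]
    exact Finset.prod_eq_zero (Finset.mem_erase.2 ⟨hne, hw⟩) (by simp)
  have key : ∀ r : Multiset K, r ≤ s + t →
      (r.map P.eval).sum = (r.count z : K) * P.eval z := by
    intro r hr
    rw [Finset.sum_multiset_map_count, Finset.sum_eq_single z, nsmul_eq_mul]
    · intro w hwr hne
      rw [hw w (Multiset.mem_toFinset.2 (Multiset.mem_of_le hr (Multiset.mem_toFinset.1 hwr))) hne,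
        smul_zero]
    · intro hzr
      rw [Multiset.count_eq_zero_of_notMem (by simpa using hzr), zero_smul]
  have := heval P
  rw [key s (Multiset.le_add_right s t), key t (Multiset.le_add_left t s)] at this
  exact_mod_cast mul_right_cancel₀ hz this

open Polynomial in
/-- An integral combination of powers of a primitive root of unity which is an integer is
unchanged when the root is replaced by a Galois conjugate. -/
theorem IsPrimitiveRoot.sum_map_pow_coprime_eq {N u : ℕ} {ζ : ℂ} (hζ : IsPrimitiveRoot ζ N)
    (hN : 0 < N) (hu : u.Coprime N) (s : Multiset ℕ) (n : ℤ)
    (h : (s.map (ζ ^ ·)).sum = n) : (s.map ((ζ ^ u) ^ ·)).sum = n := by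
  set P : ℤ[X] := (s.map (X ^ ·)).sum - C n with hP
  have haeval : ∀ z : ℂ, aeval z P = (s.map (z ^ ·)).sum - n := by
    intro z
    simp [hP, map_multiset_sum, Multiset.map_map]
  -- `P` vanishes at `ζ`, hence is divisible by its minimal polynomial, which `ζ ^ u` shares.
  have hdvd : minpoly ℤ ζ ∣ P :=
    minpoly.isIntegrallyClosed_dvd (hζ.isIntegral hN) (by rw [haeval, h, sub_self])
  rw [hζ.minpoly_eq_pow_coprime hu] at hdvd
  obtain ⟨Q, hQ⟩ := hdvd
  have := haeval (ζ ^ u)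
  rw [hQ, map_mul, minpoly.aeval, zero_mul] at this
  exact (sub_eq_zero.1 this.symm)

/-- A finite family of `N`-th roots of unity whose power sums are integers is invariant under
raising to powers prime to `N`. -/
theorem Multiset.map_pow_eq_self_of_sum_map_pow_int {N u : ℕ} (hN : 0 < N) (hu : u.Coprime N)
    (M : Multiset ℂ) (hM : ∀ z ∈ M, z ^ N = 1)
    (hint : ∀ k : ℕ, ∃ n : ℤ, (M.map (· ^ k)).sum = n) : M.map (· ^ u) = M := by
  have : NeZero N := ⟨hN.ne'⟩
  obtain ⟨ζ, hζ⟩ : ∃ ζ : ℂ, IsPrimitiveRoot ζ N := ⟨_, Complex.isPrimitiveRoot_exp N hN.ne'⟩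
  obtain ⟨s, rfl⟩ : ∃ s : Multiset ℕ, s.map (ζ ^ ·) = M := by
    have : ∀ z : ℂ, z ∈ M → ∃ i : ℕ, ζ ^ i = z := by
      intro z hz
      obtain ⟨i, -, hi⟩ := hζ.eq_pow_of_pow_eq_one (hM z hz)
      exact ⟨i, hi⟩
    choose! f hf using this
    refine ⟨M.map f, ?_⟩
    rw [Multiset.map_map]
    conv_rhs => rw [← Multiset.map_id M]
    exact Multiset.map_congr rfl hf
  apply Multiset.eq_of_forall_sum_map_pow_eq
  intro k
  obtain ⟨n, hn⟩ := hint k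
  rw [hn]
  have h1 := hζ.sum_map_pow_coprime_eq hN hu (s.map (· * k)) n (by
    rw [← hn, Multiset.map_map, Multiset.map_map]
    simp [pow_mul])
  rw [← h1]
  simp only [Multiset.map_map, Function.comp_def]
  congr 1
  refine Multiset.map_congr rfl fun i _ => ?_
  ring

/-- Galois invariance puts every primitive root of the same order as `z` into `M`, and there are
`φ(orderOf z)` of them. -/
theorem Nat.totient_orderOf_le_card_of_sum_map_pow_int {N : ℕ} (hN : 0 < N)
    (M : Multiset ℂ) (hM : ∀ z ∈ M, z ^ N = 1)
    (hint : ∀ k : ℕ, ∃ n : ℤ, (M.map (· ^ k)).sum = n) {z : ℂ} (hz : z ∈ M) :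
    (orderOf z).totient ≤ M.card := by
  have : NeZero N := ⟨hN.ne'⟩
  have hdvd : orderOf z ∣ N := orderOf_dvd_of_pow_eq_one (hM z hz)
  have hpos : 0 < orderOf z := Nat.pos_of_dvd_of_pos hdvd hN
  have : NeZero (orderOf z) := ⟨hpos.ne'⟩
  have hprim := IsPrimitiveRoot.orderOf z
  have hsub : primitiveRoots (orderOf z) ℂ ⊆ M.toFinset := by
    intro w hw
    rw [mem_primitiveRoots hpos] at hw
    obtain ⟨i, hi, hcop, rfl⟩ := hprim.isPrimitiveRoot_iff.1 hw
    -- The exponent `i` is prime only to the order of `z`; invariance of `M` needs one prime to `N`,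
    -- so `i` is lifted to a unit modulo `N`.
    obtain ⟨v, hv⟩ := ZMod.unitsMap_surjective hdvd (ZMod.unitOfCoprime i hcop)
    have hu : (v : ZMod N).val.Coprime N := ZMod.val_coe_unit_coprime v
    have hcast : (((v : ZMod N).val : ℕ) : ZMod (orderOf z)) = (i : ZMod (orderOf z)) := by
      have := congrArg (Units.val) hv
      rw [ZMod.unitsMap_val, ZMod.coe_unitOfCoprime] at this
      rw [← this, ZMod.natCast_val]
    have hmod : (v : ZMod N).val % orderOf z = i % orderOf z :=
      (ZMod.natCast_eq_natCast_iff _ _ _).1 hcast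
    have hpow : z ^ i = z ^ (v : ZMod N).val := by
      rw [← pow_mod_orderOf, ← hmod, pow_mod_orderOf]
    rw [hpow, Multiset.mem_toFinset,
      ← Multiset.map_pow_eq_self_of_sum_map_pow_int hN hu M hM hint]
    exact Multiset.mem_map_of_mem _ hz
  calc (orderOf z).totient = (primitiveRoots (orderOf z) ℂ).card := hprim.card_primitiveRoots.symm
    _ ≤ M.toFinset.card := Finset.card_le_card hsub
    _ ≤ M.card := Multiset.toFinset_card_le M

/-- A prime power `q` dividing `n` satisfies `q ≤ 2 φ(q) ≤ 12`, and all prime powers up to 12 except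
11 divide `2520 = 8 · 9 · 5 · 7`. -/
theorem Nat.dvd_2520_of_totient_le {n : ℕ} (hn : 0 < n) (h : n.totient ≤ 6) : n ∣ 2520 := by
  refine (Nat.dvd_iff_prime_pow_dvd_dvd _ _).2 fun p k hp hpk => ?_
  rcases k.eq_zero_or_pos with rfl | hk
  · simp
  have h1 : (p ^ k).totient ≤ 6 := (Nat.le_of_dvd (Nat.totient_pos.2 hn)
    (Nat.totient_dvd_of_dvd hpk)).trans h
  have h2 : p ^ k ≤ 12 := by
    rw [Nat.totient_prime_pow hp hk] at h1
    obtain ⟨j, rfl⟩ : ∃ j, k = j + 1 := ⟨k - 1, by omega⟩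
    have := hp.two_le
    rw [pow_succ]
    rw [Nat.add_sub_cancel] at h1
    have : p ≤ 2 * (p - 1) := by omega
    nlinarith [Nat.mul_le_mul_left (p ^ j) this]
  have h3 : IsPrimePow (p ^ k) := hp.isPrimePow.pow hk.ne'
  generalize p ^ k = q at h1 h2 h3
  interval_cases q <;> first | decide | skip
  -- The values left over are 0, not a prime power, and 11, of totient 10.
  · exact absurd h3 (by rw [isPrimePow_nat_iff_bounded]; decide)
  · revert h1; decide

/-! ### Simultaneous diagonalisation inside `SU(3)` -/

namespace Matrix

/-- Simultaneous unitary diagonalisation of commuting Hermitian matrices. -/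
theorem IsHermitian.exists_unitary_simultaneous_diagonal {ι : Type*} {n : ℕ}
    (T : ι → Matrix (Fin n) (Fin n) ℂ) (hT : ∀ i, (T i).IsHermitian)
    (hC : ∀ i j, T i * T j = T j * T i) :
    ∃ U ∈ unitaryGroup (Fin n) ℂ, ∀ i, ∃ d : Fin n → ℂ, T i * U = U * diagonal d := by
  classical
  let E := EuclideanSpace ℂ (Fin n)
  let S : ι → Module.End ℂ E := fun i => toEuclideanLin (T i)
  have hS : ∀ i, (S i).IsSymmetric := fun i => isSymmetric_toEuclideanLin_iff.2 (hT i)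
  have hcomm : Pairwise (Function.onFun Commute S) := by
    intro i j _
    change S i * S j = S j * S i
    simp only [S, Module.End.mul_eq_comp]
    rw [toEuclideanLin, ← toLpLin_mul_same, ← toLpLin_mul_same, hC]
  have hint := LinearMap.IsSymmetric.directSum_isInternal_of_pairwise_commute hS hcomm
  have horth := LinearMap.IsSymmetric.orthogonalFamily_iInf_eigenspaces hS
  -- Joint eigenspaces are indexed by an infinite type, but only finitely many are nonzero; these
  -- alone are used to build an orthonormal basis.
  have hfin := WellFoundedGT.finite_ne_bot_of_iSupIndep hint.submodule_iSupIndep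
  set V : (ι → ℂ) → Submodule ℂ E := fun α => ⨅ j, (S j).eigenspace (α j) with hV
  have : Fintype {α // V α ≠ ⊥} := hfin.fintype
  have hint' := DirectSum.isInternal_ne_bot_iff.2 hint
  have horth' : OrthogonalFamily ℂ (fun α : {α // V α ≠ ⊥} => V α.1)
      (fun α => (V α.1).subtypeₗᵢ) :=
    horth.comp Subtype.val_injective
  have hrank : Module.finrank ℂ E = n := finrank_euclideanSpace_fin
  let b := hint'.subordinateOrthonormalBasis hrank horth'
  have hb : ∀ k, ∃ α : ι → ℂ, ∀ i, S i (b k) = α i • b k := by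
    intro k
    have := hint'.subordinateOrthonormalBasis_subordinate hrank k horth'
    refine ⟨(hint'.subordinateOrthonormalBasisIndex hrank k horth').1, fun i => ?_⟩
    exact Module.End.mem_eigenspace_iff.1 ((Submodule.mem_iInf _).1 this i)
  choose α hα using hb
  let e := EuclideanSpace.basisFun (Fin n) ℂ
  refine ⟨e.toBasis.toMatrix b, e.toMatrix_orthonormalBasis_mem_unitary b, fun i =>
    ⟨fun k => α k i, ?_⟩⟩
  have hent : ∀ j k, e.toBasis.toMatrix b j k = b k j := by
    intro j k
    simp [Module.Basis.toMatrix_apply, e]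
  ext j k
  have h : (T i *ᵥ (b k).ofLp) j = α k i * (b k).ofLp j :=
    congrArg (fun v : E => v j) (hα k i)
  rw [mul_diagonal, hent, mul_apply]
  simp only [hent]
  simpa [mulVec, dotProduct, mul_comm] using h

end Matrix

namespace FiniteSU3

open Matrix

/-- Rescaling a unitary matrix by a cube root of its determinant. -/
theorem exists_smul_mem_SU3 {U : Matrix (Fin 3) (Fin 3) ℂ} (hU : U ∈ unitaryGroup (Fin 3) ℂ) :
    ∃ (g : SU3) (c : ℂ), (g : Matrix (Fin 3) (Fin 3) ℂ) = c • U := by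
  obtain ⟨c, hc⟩ : ∃ c : ℂ, c ^ 3 = U.det⁻¹ := IsAlgClosed.exists_pow_nat_eq _ (by norm_num)
  have hdet : ‖U.det‖ = 1 := CStarRing.norm_of_mem_unitary (det_of_mem_unitary hU)
  have hdet0 : U.det ≠ 0 := by
    intro h
    simp [h] at hdet
  have hnorm : ‖c‖ = 1 := by
    have : ‖c‖ ^ 3 = 1 := by rw [← norm_pow, hc, norm_inv, hdet, inv_one]
    exact (pow_eq_one_iff_of_nonneg (norm_nonneg c) (by norm_num)).1 this
  refine ⟨⟨c • U, ?_⟩, c, rfl⟩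
  rw [mem_specialUnitaryGroup_iff]
  constructor
  · rw [mem_unitaryGroup_iff] at hU ⊢
    rw [star_smul, smul_mul_smul_comm, hU, Complex.star_def, Complex.mul_conj,
      Complex.normSq_eq_norm_sq, hnorm]
    simp
  · rw [det_smul, Fintype.card_fin, hc, inv_mul_cancel₀ hdet0]

/-- A commutative subgroup of `SU(3)` is conjugate to a group of diagonal matrices. -/
theorem exists_conj_isDiag (H : Subgroup SU3) (hab : ∀ A ∈ H, ∀ B ∈ H, A * B = B * A) :
    ∃ g : SU3, ∀ A ∈ H, ∃ d : Fin 3 → ℂ,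
      ((g * A * g⁻¹ : SU3) : Matrix (Fin 3) (Fin 3) ℂ) = diagonal d := by
  let m : SU3 → Matrix (Fin 3) (Fin 3) ℂ := fun A => A
  have hmul : ∀ A B, m (A * B) = m A * m B := fun _ _ => rfl
  have hinv : ∀ A : SU3, m A⁻¹ = (m A)ᴴ := fun _ => rfl
  have hcomm : ∀ A ∈ H, ∀ B ∈ H, m A * m B = m B * m A := fun A hA B hB => by
    rw [← hmul, ← hmul, hab A hA B hB]
  -- For unitary `A` both `A + A⁻¹` and `i(A - A⁻¹)` are Hermitian, and `A` is a linear combination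
  -- of them.
  let T : H × Bool → Matrix (Fin 3) (Fin 3) ℂ := fun p =>
    if p.2 then m p.1 + m (p.1 : SU3)⁻¹ else Complex.I • (m p.1 - m (p.1 : SU3)⁻¹)
  have hT : ∀ p, (T p).IsHermitian := by
    rintro ⟨A, _ | _⟩
    · simp only [T, hinv, IsHermitian, conjTranspose_smul, conjTranspose_sub,
        conjTranspose_conjTranspose, Complex.star_def, Complex.conj_I, Bool.false_eq_true, if_false]
      rw [neg_smul, ← smul_neg, neg_sub]
    · simp only [T, hinv, IsHermitian, conjTranspose_add, conjTranspose_conjTranspose, if_true]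
      rw [add_comm]
  have hC : ∀ p q, T p * T q = T q * T p := by
    have key : ∀ A B : H, Commute (m A) (m B) := fun A B => hcomm _ A.2 _ B.2
    have key' : ∀ A B : H, Commute (m A) (m (B : SU3)⁻¹) := fun A B =>
      hcomm _ A.2 _ (H.inv_mem B.2)
    have key'' : ∀ A B : H, Commute (m (A : SU3)⁻¹) (m (B : SU3)⁻¹) := fun A B =>
      hcomm _ (H.inv_mem A.2) _ (H.inv_mem B.2)
    rintro ⟨A, a⟩ ⟨B, b⟩
    have hp : Commute (m A + m (A : SU3)⁻¹) (m B + m (B : SU3)⁻¹) :=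
      ((key A B).add_right (key' A B)).add_left ((key' B A).symm.add_right (key'' A B))
    have hq : Commute (m A - m (A : SU3)⁻¹) (m B - m (B : SU3)⁻¹) :=
      ((key A B).sub_right (key' A B)).sub_left ((key' B A).symm.sub_right (key'' A B))
    have hr : ∀ A B : H, Commute (m A + m (A : SU3)⁻¹) (m B - m (B : SU3)⁻¹) := fun A B =>
      ((key A B).sub_right (key' A B)).add_left ((key' B A).symm.sub_right (key'' A B))
    change Commute _ _
    cases a <;> cases b
    · exact (hq.smul_left _).smul_right _
    · exact (hr B A).symm.smul_left _
    · exact (hr A B).smul_right _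
    · exact hp
  obtain ⟨U, hU, hd⟩ := IsHermitian.exists_unitary_simultaneous_diagonal T hT hC
  obtain ⟨g, c, hg⟩ := exists_smul_mem_SU3 hU
  refine ⟨g⁻¹, fun A hA => ?_⟩
  obtain ⟨d₁, h₁⟩ := hd (⟨A, hA⟩, true)
  obtain ⟨d₂, h₂⟩ := hd (⟨A, hA⟩, false)
  refine ⟨fun i => (1 / 2 : ℂ) * d₁ i + (-Complex.I / 2) * d₂ i, ?_⟩
  have hA2 : m A = (1 / 2 : ℂ) • T (⟨A, hA⟩, true) + (-Complex.I / 2) • T (⟨A, hA⟩, false) := by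
    simp only [T, Bool.false_eq_true, if_false, if_true, smul_smul]
    have : -Complex.I / 2 * Complex.I = 1 / 2 := by
      linear_combination (-1 / 2 : ℂ) * Complex.I_sq
    rw [this, ← smul_add, add_add_sub_cancel, ← two_smul ℂ (m A), smul_smul]
    norm_num
  have hAU : m A * U = U * diagonal (fun i => (1 / 2 : ℂ) * d₁ i + (-Complex.I / 2) * d₂ i) := by
    rw [hA2, add_mul, smul_mul_assoc, smul_mul_assoc, h₁, h₂, ← mul_smul_comm, ← mul_smul_comm,
      ← mul_add]
    congr 1
    ext i j
    simp only [Matrix.add_apply, Matrix.smul_apply, diagonal_apply, smul_eq_mul]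
    split_ifs <;> simp
  change m (g⁻¹ * A * g⁻¹⁻¹) = _
  have hgg : m g⁻¹ * m g = 1 := by rw [← hmul, inv_mul_cancel]; rfl
  have hg' : m g = c • U := hg
  rw [inv_inv, hmul, hmul, mul_assoc, hg', mul_smul_comm, hAU, ← smul_mul_assoc, ← hg',
    ← mul_assoc, hgg, one_mul]

end FiniteSU3

/-! ### Lattices of eigenvalue ratios and the finite checks -/

namespace FiniteSU3

/-- All labels. -/
def labels : List AbelianLabel :=
  [.A_1_1, .A_1_2, .A_1_3, .A_1_4_1, .A_1_4_2, .A_1_6_1, .A_1_6_2, .A_1_7, .A_1_8_1, .A_1_8_2,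
    .A_1_12, .A_2_2, .A_2_4, .A_2_6, .A_3_1, .A_3_2, .A_3_3, .A_3_4, .A_3_6, .A_4_4, .A_6_2, .A_6_6]

theorem mem_labels (l : AbelianLabel) : l ∈ labels := by
  cases l <;> simp [labels]

/-- Vectors `(x, y)` such that the matrices with eigenvalue ratios `e(x/2520)`, `e(y/2520)` generate
`abelianGroup l`. -/
def latticeGens : AbelianLabel → List (ℤ × ℤ)
  | .A_1_1 => [(-2520, 0)]
  | .A_1_2 => [(-6300, 0)]
  | .A_1_3 => [(-3360, 0)]
  | .A_1_4_1 => [(-3150, 0)]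
  | .A_1_4_2 => [(-1890, -1260)]
  | .A_1_6_1 => [(-7140, 0)]
  | .A_1_6_2 => [(-2940, -1260)]
  | .A_1_7 => [(-4320, 1440)]
  | .A_1_8_1 => [(-2205, -1890)]
  | .A_1_8_2 => [(-2835, -1260)]
  | .A_1_12 => [(-2730, -1260)]
  | .A_2_2 => [(-3780, 0), (-2520, -1260)]
  | .A_2_4 => [(-1260, -1260), (-3150, 0)]
  | .A_2_6 => [(-1260, -1260), (-7140, 0)]
  | .A_3_1 => [(-1680, -1680), (-2520, 0)]
  | .A_3_2 => [(-1680, -1680), (-1260, 0)]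
  | .A_3_3 => [(-3360, -840), (-2520, -1680)]
  | .A_3_4 => [(-3360, -840), (-3150, 0)]
  | .A_3_6 => [(-3360, -840), (-2940, -840)]
  | .A_4_4 => [(-3150, -1260), (-2520, -1890)]
  | .A_6_2 => [(-2100, -2100), (-1260, 0)]
  | .A_6_6 => [(-2940, -1680), (-2520, -2100)]

/-- `(p, q, r)` such that `(p, q)` and `(0, r)` form a basis of the lattice of `abelianGroup l`. -/
def latticeBasis : AbelianLabel → ℕ × ℕ × ℕ
  | .A_1_1 => (2520, 0, 2520)
  | .A_1_2 => (1260, 0, 2520)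
  | .A_1_3 => (840, 0, 2520)
  | .A_1_4_1 => (630, 0, 2520)
  | .A_1_4_2 => (630, 1260, 2520)
  | .A_1_6_1 => (420, 0, 2520)
  | .A_1_6_2 => (420, 1260, 2520)
  | .A_1_7 => (360, 720, 2520)
  | .A_1_8_1 => (315, 630, 2520)
  | .A_1_8_2 => (315, 1260, 2520)
  | .A_1_12 => (210, 1260, 2520)
  | .A_2_2 => (1260, 0, 1260)
  | .A_2_4 => (630, 0, 1260)
  | .A_2_6 => (420, 0, 1260)
  | .A_3_1 => (840, 840, 2520)
  | .A_3_2 => (420, 1680, 2520)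
  | .A_3_3 => (840, 0, 840)
  | .A_3_4 => (210, 840, 2520)
  | .A_3_6 => (420, 0, 840)
  | .A_4_4 => (630, 0, 630)
  | .A_6_2 => (420, 420, 1260)
  | .A_6_6 => (420, 0, 420)

/-- The basis vectors as integral combinations of the generators and the relations. -/
def latticeCoeffs : AbelianLabel → List ℤ × List ℤ
  | .A_1_1 => ([-1, 0, 0], [1, 1, 0])
  | .A_1_2 => ([1, 0, 1], [-2, 1, -2])
  | .A_1_3 => ([2, 0, 1], [3, 1, 1])
  | .A_1_4_1 => ([-5, 0, -2], [-4, 1, -2])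
  | .A_1_4_2 => ([1, 1, 0], [4, 3, 0])
  | .A_1_6_1 => ([1, 0, 1], [-6, 1, -6])
  | .A_1_6_2 => ([5, 3, 1], [6, 4, 1])
  | .A_1_7 => ([4, -2, 3], [7, -3, 5])
  | .A_1_8_1 => ([1, 1, 0], [8, 7, 0])
  | .A_1_8_2 => ([-9, -4, -2], [-8, -3, -2])
  | .A_1_12 => ([11, 6, 2], [12, 7, 2])
  | .A_2_2 => ([-1, 2, 1, 0], [0, 1, 1, 0])
  | .A_2_4 => ([0, -5, 0, -2], [-1, -2, 0, -1])
  | .A_2_6 => ([0, 1, 0, 1], [-1, -3, 0, -3])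
  | .A_3_1 => ([1, 0, 1, 0], [0, 1, 1, 0])
  | .A_3_2 => ([-1, 1, 0, 0], [0, 2, 1, 0])
  | .A_3_3 => ([-1, 2, 1, 0], [0, 1, 1, 0])
  | .A_3_4 => ([-1, 1, 0, 0], [0, -4, 1, -2])
  | .A_3_6 => ([-1, 1, 0, 0], [1, -8, -2, -2])
  | .A_4_4 => ([-1, 2, 1, 0], [0, 1, 1, 0])
  | .A_6_2 => ([1, 0, 1, 0], [-3, 1, -2, 0])
  | .A_6_6 => ([-1, 2, 1, 0], [0, 1, 1, 0])

/-- Labels of some groups which contain a conjugate of `abelianGroup l`. -/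
def larger : AbelianLabel → List AbelianLabel
  | .A_1_1 => [.A_1_2, .A_1_7, .A_1_3, .A_3_1]
  | .A_1_2 => [.A_1_3, .A_1_4_1, .A_3_1, .A_1_4_2, .A_2_2]
  | .A_1_3 => [.A_1_6_1, .A_1_6_2, .A_3_3]
  | .A_1_4_1 => [.A_2_4, .A_3_2, .A_1_8_2]
  | .A_1_4_2 => [.A_2_4, .A_1_6_1, .A_1_8_1]
  | .A_1_6_1 => [.A_3_3, .A_1_12, .A_2_6]
  | .A_1_6_2 => [.A_3_3, .A_2_6]
  | .A_1_7 => []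
  | .A_1_8_1 => []
  | .A_1_8_2 => []
  | .A_1_12 => []
  | .A_2_2 => [.A_1_6_1, .A_2_4, .A_3_2]
  | .A_2_4 => [.A_4_4]
  | .A_2_6 => [.A_3_6]
  | .A_3_1 => [.A_3_2, .A_3_3]
  | .A_3_2 => [.A_3_3, .A_3_4, .A_6_2]
  | .A_3_3 => [.A_3_6]
  | .A_3_4 => []
  | .A_3_6 => [.A_6_6]
  | .A_4_4 => []
  | .A_6_2 => [.A_3_6]
  | .A_6_6 => []


/-- The index of `2520 ℤ²` in the lattice of a label. -/
def latticeSize (l : AbelianLabel) : ℕ :=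
  let (p, _, r) := latticeBasis l
  (2520 / p) * (2520 / r)

/-- Membership in the lattice of a label. -/
def latticeMem (l : AbelianLabel) (x y : ℕ) : Bool :=
  let (p, q, r) := latticeBasis l
  -- `2520 - q` plays the role of `-q`, because `r` divides 2520 and `q ≤ 2520`.
  Nat.beq (x % p) 0 && Nat.beq ((y + (2520 - q) * (x / p)) % r) 0

/-- The two basis vectors of the lattice of a label. -/
def latticeVec (l : AbelianLabel) : List (ℕ × ℕ) :=
  let (p, q, r) := latticeBasis l
  [(p, q), (0, r)]

/-- Representatives of the lattice of a label modulo `2520`. -/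
def latticeReps (l : AbelianLabel) : List (ℕ × ℕ) :=
  let (p, q, r) := latticeBasis l
  (List.range (2520 / p)).flatMap fun s => (List.range (2520 / r)).map fun t =>
    (s * p, s * q + t * r)

/-- A representative of `-x` modulo `2520`. -/
def negRep (x : ℕ) : ℕ := 2520 - x % 2520

/-- The images of a pair of eigenvalue ratios under the permutations of the eigenvalues. -/
def permImages (x y : ℕ) : List (ℕ × ℕ) :=
  [(x, y), (negRep x, x + y), (x + y, negRep y), (negRep y, negRep x), (y, negRep (x + y)),
    (negRep (x + y), x)]

/-- Whether the root of unity `e(x/2520)` has degree at most `6`. -/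
def smallOrder (x : ℕ) : Bool :=
  -- Every `n` with `φ(n) ≤ 6` divides one of these five numbers.
  [8, 10, 12, 14, 18].any fun n => Nat.beq (n * x % 2520) 0

/-- An even function separating enough residues modulo `2520`. -/
def weight (x : ℕ) : ℕ := (x % 2520 * (2520 - x % 2520)) ^ 2

/-- A necessary condition on the eigenvalue ratios of a matrix all of whose powers have
integral squared trace: the six nontrivial roots have degree at most `6`, and `z ↦ z ^ 67`
preserves the sum of their weights. -/
def admissible (x y : ℕ) : Bool :=
  smallOrder x && (smallOrder y &&
    -- Modulo each of 8, 10, 12, 14, 18 the units are generated by 67 and -1. The weight is even, so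
    -- one root from each inverse pair suffices.
    Nat.beq (weight (67 * x) + weight (67 * y) + weight (67 * (x + y)))
      (weight x + weight y + weight (x + y)))

/-- Representatives of the exponents of the roots of unity of degree at most `6`. -/
def smallExps : List ℕ :=
  ([8, 10, 12, 14, 18].flatMap fun n => (List.range n).map fun i => i * (2520 / n)).eraseDups

/-- Adding a vector to the lattice of `l` produces a vector which is not admissible. -/
def leaves (l : AbelianLabel) (x y : ℕ) : Bool :=
  (latticeReps l).any fun w => [1, 2, 3].any fun k => ! admissible (w.1 + k * x) (w.2 + k * y)

/-- The lattice of `l` together with a vector contains the image of `w` under the permutation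
number `i`. -/
def spans (l : AbelianLabel) (x y : ℕ) (i : ℕ) (w : ℕ × ℕ) : Bool :=
  let w' := (permImages w.1 w.2).getD i w
  (List.range 12).any fun k => latticeMem l (w'.1 + k * x) (w'.2 + k * y)

/-- The lattice of `l` together with a vector contains a permutation of the lattice of a
larger label. -/
def enlarges (l : AbelianLabel) (x y : ℕ) : Bool :=
  (larger l).any fun l' => (List.range 6).any fun i => (latticeVec l').all (spans l x y i)

/-- Some permutation maps the lattice of `l` into the lattice of `l'`. -/
def embeds (l l' : AbelianLabel) : Bool :=
  (List.range 6).any fun i => (latticeVec l).all fun w =>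
    latticeMem l' ((permImages w.1 w.2).getD i w).1 ((permImages w.1 w.2).getD i w).2

theorem smallExps_check :
    ((List.range 2520).all fun x => !smallOrder x || smallExps.elem x) = true := by
  decide +kernel

/-- The inductive step of the classification, by enumeration: a vector outside a listed lattice is
inadmissible, generates an inadmissible vector with the lattice, or leads to a larger listed
lattice. -/
theorem step_check : (smallExps.all fun x => smallExps.all fun y => !admissible x y ||
    labels.all fun l => latticeMem l x y || (leaves l x y || enlarges l x y)) = true := by
  decide +kernel

theorem larger_check : (labels.all fun l => (larger l).all fun l' =>
    Nat.blt (latticeSize l) (latticeSize l')) = true := by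
  decide +kernel

/-- The source of uniqueness: different listed lattices never embed into each other both ways under
permutations. -/
theorem embed_check : (labels.all fun l => labels.all fun l' => Nat.beq l.ctorIdx l'.ctorIdx ||
    !(embeds l l' && embeds l' l)) = true := by
  decide +kernel

theorem smallOrder_mod {x : ℕ} : smallOrder (x % 2520) = smallOrder x := by
  simp [smallOrder, Nat.mul_mod]

theorem mem_smallExps {x : ℕ} (h : smallOrder x = true) : x % 2520 ∈ smallExps := by
  have := List.all_eq_true.1 smallExps_check (x % 2520)
    (List.mem_range.2 (Nat.mod_lt _ (by norm_num)))
  rw [smallOrder_mod, h] at this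
  simpa using this

theorem step_of_admissible (l : AbelianLabel) {x y : ℕ} (hx : x < 2520) (hy : y < 2520)
    (h : admissible x y = true) :
    latticeMem l x y = true ∨ leaves l x y = true ∨ enlarges l x y = true := by
  have hx' : x ∈ smallExps := by
    have := mem_smallExps (x := x) (by simp_all [admissible])
    rwa [Nat.mod_eq_of_lt hx] at this
  have hy' : y ∈ smallExps := by
    have := mem_smallExps (x := y) (by simp_all [admissible])
    rwa [Nat.mod_eq_of_lt hy] at this
  have := List.all_eq_true.1 (List.all_eq_true.1 step_check x hx') y hy'
  rw [h] at this
  have := List.all_eq_true.1 this l (mem_labels l)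
  simpa only [Bool.or_eq_true] using this

theorem latticeSize_lt {l l' : AbelianLabel} (h : l' ∈ larger l) :
    latticeSize l < latticeSize l' := by
  have := List.all_eq_true.1 (List.all_eq_true.1 larger_check l (mem_labels l)) l' h
  simpa [Nat.blt_eq] using this

theorem eq_of_embeds {l l' : AbelianLabel} (h : embeds l l' = true) (h' : embeds l' l = true) :
    l = l' := by
  have := List.all_eq_true.1 (List.all_eq_true.1 embed_check l (mem_labels l)) l' (mem_labels l')
  rw [h, h'] at this
  have hidx : l.ctorIdx = l'.ctorIdx := by simpa using this
  -- `labels` follows the order of the constructors, so the index recovers the label.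
  have hinv : ∀ l : AbelianLabel, labels[l.ctorIdx]? = some l := by
    intro l
    cases l <;> rfl
  have := hinv l
  rw [hidx, hinv l'] at this
  exact (Option.some.inj this).symm

/-- The lattice of pairs `(x, y)` such that `e(x/2520)`, `e(y/2520)` are the eigenvalue ratios of
an element of `abelianGroup l`. -/
def lattice (l : AbelianLabel) : AddSubgroup (ℤ × ℤ) :=
  AddSubgroup.closure {w | ∃ v ∈ latticeVec l, w = ((v.1 : ℤ), (v.2 : ℤ))}

theorem mem_lattice_iff {l : AbelianLabel} {v : ℤ × ℤ} :
    v ∈ lattice l ↔ ∃ m n : ℤ, v.1 = m * (latticeBasis l).1 ∧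
      v.2 = m * (latticeBasis l).2.1 + n * (latticeBasis l).2.2 := by
  have : {w : ℤ × ℤ | ∃ v ∈ latticeVec l, w = ((v.1 : ℤ), (v.2 : ℤ))} =
      {(((latticeBasis l).1 : ℤ), ((latticeBasis l).2.1 : ℤ)),
        ((0 : ℤ), ((latticeBasis l).2.2 : ℤ))} := by
    ext w
    simp [latticeVec]
  rw [lattice, this, AddSubgroup.mem_closure_pair]
  refine exists_congr fun m => exists_congr fun n => ?_
  rw [Prod.ext_iff]
  simp [eq_comm]

theorem latticeBasis_spec (l : AbelianLabel) : 0 < (latticeBasis l).1 ∧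
    (latticeBasis l).2.1 ≤ 2520 ∧ (latticeBasis l).2.2 ∣ 2520 := by
  cases l <;> decide

theorem latticeMem_iff {l : AbelianLabel} {x y : ℕ} :
    latticeMem l x y = true ↔ ((x : ℤ), (y : ℤ)) ∈ lattice l := by
  obtain ⟨hp, hq, hr⟩ := latticeBasis_spec l
  rw [mem_lattice_iff]
  simp only [latticeMem, Bool.and_eq_true, Nat.beq_eq]
  generalize (latticeBasis l).1 = p at *
  generalize (latticeBasis l).2.1 = q at *
  generalize (latticeBasis l).2.2 = r at *
  obtain ⟨c, hc⟩ := hr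
  have hc' : (r : ℤ) * c = 2520 := by exact_mod_cast hc.symm
  constructor
  · rintro ⟨h1, h2⟩
    obtain ⟨s, rfl⟩ := Nat.dvd_of_mod_eq_zero h1
    rw [Nat.mul_div_cancel_left _ hp] at h2
    obtain ⟨t, ht⟩ := Nat.dvd_of_mod_eq_zero h2
    -- Replacing `-q` by `2520 - q` added `2520 s = r c s`, which is taken off here.
    refine ⟨s, t - c * s, by push_cast; ring, ?_⟩
    zify [hq] at ht
    linear_combination ht + (s : ℤ) * hc'
  · rintro ⟨m, n, h1, h2⟩
    have hp' : (0 : ℤ) < p := by exact_mod_cast hp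
    have hm : 0 ≤ m := by
      by_contra! hneg
      have : m * (p : ℤ) < 0 := mul_neg_of_neg_of_pos hneg hp'
      omega
    lift m to ℕ using hm
    have hx : x = m * p := by exact_mod_cast h1
    subst hx
    refine ⟨Nat.mul_mod_left _ _, ?_⟩
    rw [Nat.mul_div_cancel _ hp]
    apply Nat.mod_eq_zero_of_dvd
    zify [hq]
    refine ⟨n + c * m, ?_⟩
    linear_combination h2 - (m : ℤ) * hc'

theorem smul_mem_lattice (l : AbelianLabel) (a b : ℤ) :
    (2520 * a, 2520 * b) ∈ lattice l := by
  have h1 : ((2520 : ℤ), (0 : ℤ)) ∈ lattice l := by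
    have : latticeMem l 2520 0 = true := by cases l <;> rfl
    simpa using latticeMem_iff.1 this
  have h2 : ((0 : ℤ), (2520 : ℤ)) ∈ lattice l := by
    have : latticeMem l 0 2520 = true := by cases l <;> rfl
    simpa using latticeMem_iff.1 this
  have := (lattice l).add_mem ((lattice l).zsmul_mem h1 a) ((lattice l).zsmul_mem h2 b)
  simpa [mul_comm] using this

/-- The permutation action on pairs of eigenvalue ratios. -/
def permAct (σ : Equiv.Perm (Fin 3)) : ℤ × ℤ →+ ℤ × ℤ where
  toFun v := ((![v.1 + v.2, v.2, 0] : Fin 3 → ℤ) (σ 0) - (![v.1 + v.2, v.2, 0] : Fin 3 → ℤ) (σ 1),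
    (![v.1 + v.2, v.2, 0] : Fin 3 → ℤ) (σ 1) - (![v.1 + v.2, v.2, 0] : Fin 3 → ℤ) (σ 2))
  map_zero' := by
    have : (![0, 0, 0] : Fin 3 → ℤ) = 0 := by ext i; fin_cases i <;> rfl
    simp [this]
  map_add' v w := by
    have : ∀ i, (![v.1 + w.1 + (v.2 + w.2), v.2 + w.2, 0] : Fin 3 → ℤ) i =
        (![v.1 + v.2, v.2, 0] : Fin 3 → ℤ) i + (![w.1 + w.2, w.2, 0] : Fin 3 → ℤ) i := by
      intro i
      fin_cases i <;> simp; ring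
    simp only [Prod.fst_add, Prod.snd_add, this, Prod.mk_add_mk, Prod.mk.injEq]
    constructor <;> ring

/-- The permutations of three letters, in the order used by `permImages`. -/
def perms : List (Equiv.Perm (Fin 3)) :=
  [1, Equiv.swap 0 1, Equiv.swap 1 2, Equiv.swap 0 2, Equiv.swap 0 1 * Equiv.swap 1 2,
    Equiv.swap 1 2 * Equiv.swap 0 1]

theorem exists_perms_eq (σ : Equiv.Perm (Fin 3)) : ∃ i < 6, perms.getD i 1 = σ := by
  revert σ
  decide

theorem negRep_eq (x : ℕ) : ∃ a : ℤ, (negRep x : ℤ) = -x + 2520 * a := by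
  refine ⟨1 + x / 2520, ?_⟩
  rw [negRep]
  omega

theorem permImages_eq {i : ℕ} (hi : i < 6) (w : ℕ × ℕ) : ∃ a b : ℤ,
    ((((permImages w.1 w.2).getD i w).1 : ℤ), (((permImages w.1 w.2).getD i w).2 : ℤ)) =
      permAct (perms.getD i 1) ((w.1 : ℤ), (w.2 : ℤ)) + (2520 * a, 2520 * b) := by
  obtain ⟨x, y⟩ := w
  obtain ⟨a, ha⟩ := negRep_eq x
  obtain ⟨b, hb⟩ := negRep_eq y
  obtain ⟨c, hc⟩ := negRep_eq (x + y)
  have h1 : (Equiv.swap (0 : Fin 3) 1) 2 = 2 := by decide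
  have h2 : (Equiv.swap (1 : Fin 3) 2) 0 = 0 := by decide
  have h3 : (Equiv.swap (0 : Fin 3) 2) 1 = 1 := by decide
  interval_cases i
  · exact ⟨0, 0, by simp [permImages, perms, permAct]⟩
  · exact ⟨a, 0, by simp [permImages, perms, permAct, ha, h1]⟩
  · exact ⟨0, b, by simp [permImages, perms, permAct, hb, h2]⟩
  · exact ⟨b, a, by simp [permImages, perms, permAct, ha, hb, h3]⟩
  · exact ⟨0, c, by simp [permImages, perms, permAct, hc, h1, h2]⟩
  · exact ⟨c, 0, by simp [permImages, perms, permAct, hc, h1, h2]⟩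

/-- Two labels whose lattices embed into each other by permutations are equal. -/
theorem eq_of_lattice_le_comap {l l' : AbelianLabel} {σ τ : Equiv.Perm (Fin 3)}
    (hσ : lattice l ≤ (lattice l').comap (permAct σ))
    (hτ : lattice l' ≤ (lattice l).comap (permAct τ)) : l = l' := by
  have key : ∀ {l l' : AbelianLabel} {σ : Equiv.Perm (Fin 3)},
      lattice l ≤ (lattice l').comap (permAct σ) → embeds l l' = true := by
    intro l l' σ h
    obtain ⟨i, hi, rfl⟩ := exists_perms_eq σ
    refine List.any_eq_true.2 ⟨i, List.mem_range.2 hi, List.all_eq_true.2 fun w hw => ?_⟩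
    obtain ⟨a, b, hab⟩ := permImages_eq hi w
    rw [latticeMem_iff, hab]
    exact (lattice l').add_mem (h (AddSubgroup.subset_closure ⟨w, hw, rfl⟩))
      (smul_mem_lattice l' a b)
  exact eq_of_embeds (key hσ) (key hτ)

/-- A group of admissible vectors which strictly contains the lattice of a label contains a
permutation of the lattice of a label of larger size. -/
theorem exists_larger_lattice {Λ : AddSubgroup (ℤ × ℤ)}
    (hadm : ∀ x y : ℕ, ((x : ℤ), (y : ℤ)) ∈ Λ → admissible x y = true) {l : AbelianLabel}
    (hl : lattice l ≤ Λ) (hne : ¬ Λ ≤ lattice l) :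
    ∃ l', latticeSize l < latticeSize l' ∧ ∃ σ, lattice l' ≤ Λ.comap (permAct σ) := by
  obtain ⟨v, hv, hvl⟩ := SetLike.not_le_iff_exists.1 hne
  have hred : ∃ x y : ℕ, x < 2520 ∧ y < 2520 ∧ ∃ a b : ℤ,
      ((x : ℤ), (y : ℤ)) = v + (2520 * a, 2520 * b) := by
    refine ⟨(v.1 % 2520).toNat, (v.2 % 2520).toNat, by omega, by omega, -(v.1 / 2520),
      -(v.2 / 2520), ?_⟩
    ext <;> simp only [Prod.fst_add, Prod.snd_add] <;> omega
  obtain ⟨x, y, hx, hy, a, b, hxy⟩ := hred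
  have hxyΛ : ((x : ℤ), (y : ℤ)) ∈ Λ := by
    rw [hxy]
    exact Λ.add_mem hv (hl (smul_mem_lattice l a b))
  have hxyl : ((x : ℤ), (y : ℤ)) ∉ lattice l := by
    rw [hxy]
    exact fun h => hvl ((AddSubgroup.add_mem_cancel_right _ (smul_mem_lattice l a b)).1 h)
  rcases step_of_admissible l hx hy (hadm x y hxyΛ) with h | h | h
  -- The first two outcomes are impossible: the vector lies outside `lattice l`, and all of `Λ` is
  -- admissible.
  · exact absurd (latticeMem_iff.1 h) hxyl
  · exfalso
    obtain ⟨w, hw, h⟩ := List.any_eq_true.1 h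
    obtain ⟨k, -, h⟩ := List.any_eq_true.1 h
    have hwl : ((w.1 : ℤ), (w.2 : ℤ)) ∈ lattice l := by
      simp only [latticeReps, List.mem_flatMap, List.mem_map] at hw
      obtain ⟨s, -, t, -, rfl⟩ := hw
      exact mem_lattice_iff.2 ⟨s, t, by push_cast; ring, by push_cast; ring⟩
    have : admissible (w.1 + k * x) (w.2 + k * y) = true := by
      apply hadm
      have := Λ.add_mem (hl hwl) (Λ.nsmul_mem hxyΛ k)
      simpa using this
    simp [this] at h
  · obtain ⟨l', hl', h⟩ := List.any_eq_true.1 h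
    obtain ⟨i, hi, h⟩ := List.any_eq_true.1 h
    refine ⟨l', latticeSize_lt hl', perms.getD i 1, ?_⟩
    rw [lattice, AddSubgroup.closure_le]
    rintro _ ⟨w, hw, rfl⟩
    obtain ⟨a, b, hab⟩ := permImages_eq (List.mem_range.1 hi) w
    obtain ⟨k, -, hk⟩ := List.any_eq_true.1 (List.all_eq_true.1 h w hw)
    have hmem := hl (latticeMem_iff.1 hk)
    have h2 : ((((permImages w.1 w.2).getD i w).1 : ℤ),
        (((permImages w.1 w.2).getD i w).2 : ℤ)) ∈ Λ := by
      have := Λ.sub_mem hmem (Λ.nsmul_mem hxyΛ k)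
      simpa using this
    rw [hab] at h2
    exact (AddSubgroup.add_mem_cancel_right _ (hl (smul_mem_lattice l a b))).1 h2

end FiniteSU3

/-! ### Parametrising diagonal matrices by their eigenvalue ratios -/

namespace FiniteSU3

open Matrix

theorem e_zero : e 0 = 1 := by simpa using e_int 0

theorem e_ne_zero (x : ℚ) : e x ≠ 0 := Complex.exp_ne_zero _

theorem e_nsmul (n : ℕ) (x : ℚ) : e (n * x) = e x ^ n := by
  rw [e, e, ← Complex.exp_nat_mul]
  push_cast
  ring_nf

theorem e_eq_one_iff {x : ℚ} : e x = 1 ↔ ∃ n : ℤ, x = n := by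
  constructor
  · rw [e, Complex.exp_eq_one_iff]
    rintro ⟨n, hn⟩
    refine ⟨n, ?_⟩
    have h2 : (2 * Real.pi * Complex.I : ℂ) ≠ 0 := Complex.two_pi_I_ne_zero
    rw [mul_comm] at hn
    exact_mod_cast mul_right_cancel₀ h2 hn
  · rintro ⟨n, rfl⟩
    exact e_int n

theorem e_eq_iff {x y : ℚ} : e x = e y ↔ ∃ n : ℤ, x = y + n := by
  have h : e x = e (x - y) * e y := by rw [← e_add, sub_add_cancel]
  rw [h, mul_eq_right₀ (e_ne_zero y), e_eq_one_iff]
  simp only [sub_eq_iff_eq_add']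

theorem exists_e_eq_of_pow_eq_one {n : ℕ} (hn : 0 < n) {z : ℂ} (hz : z ^ n = 1) :
    ∃ k : ℤ, z = e (k / n) := by
  have : NeZero n := ⟨hn.ne'⟩
  obtain ⟨i, -, rfl⟩ := (Complex.isPrimitiveRoot_exp n hn.ne').eq_pow_of_pow_eq_one hz
  refine ⟨i, ?_⟩
  rw [e, ← Complex.exp_nat_mul]
  push_cast
  ring_nf

/-- The diagonal matrix in `SU(3)` whose successive eigenvalue ratios are `e(x/2520)` and
`e(y/2520)`. -/
noncomputable def torus (v : ℤ × ℤ) : SU3 :=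
  D ((2 * v.1 + v.2) / 7560) ((v.2 - v.1) / 7560) (-(v.1 + 2 * v.2) / 7560) ⟨0, by push_cast; ring⟩

/-- The exponents of the eigenvalues of `torus v`. -/
def torusExp (v : ℤ × ℤ) : Fin 3 → ℚ :=
  ![(2 * v.1 + v.2) / 7560, (v.2 - v.1) / 7560, -(v.1 + 2 * v.2) / 7560]

theorem coe_torus (v : ℤ × ℤ) :
    (torus v : Matrix (Fin 3) (Fin 3) ℂ) = diagonal fun i => e (torusExp v i) := by
  change diagonal _ = _
  congr 1
  ext i
  fin_cases i <;> rfl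

theorem torus_eq_iff {v : ℤ × ℤ} {A : SU3} {d : Fin 3 → ℂ}
    (hA : (A : Matrix (Fin 3) (Fin 3) ℂ) = diagonal d) :
    A = torus v ↔ ∀ i, d i = e (torusExp v i) := by
  rw [Subtype.ext_iff, hA, coe_torus, diagonal_injective.eq_iff, funext_iff]

theorem torusExp_add (v w : ℤ × ℤ) (i : Fin 3) :
    torusExp (v + w) i = torusExp v i + torusExp w i := by
  fin_cases i <;> simp [torusExp] <;> ring

theorem torus_add (v w : ℤ × ℤ) : torus (v + w) = torus v * torus w := by
  symm
  rw [torus_eq_iff (d := fun i => e (torusExp v i) * e (torusExp w i))]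
  · intro i
    rw [torusExp_add, e_add]
  · rw [Submonoid.coe_mul, coe_torus, coe_torus, diagonal_mul_diagonal]

theorem torus_zero : torus 0 = 1 := by
  have := torus_add 0 0
  rwa [add_zero, left_eq_mul] at this

theorem torus_neg (v : ℤ × ℤ) : torus (-v) = (torus v)⁻¹ := by
  rw [eq_inv_iff_mul_eq_one, ← torus_add, neg_add_cancel, torus_zero]

/-- The exponents of the elements of a group of diagonal matrices. -/
def torusLattice (H : Subgroup SU3) : AddSubgroup (ℤ × ℤ) where
  carrier := {v | torus v ∈ H}
  add_mem' {v w} hv hw := by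
    change torus (v + w) ∈ H
    rw [torus_add]
    exact H.mul_mem hv hw
  zero_mem' := by
    change torus 0 ∈ H
    rw [torus_zero]
    exact H.one_mem
  neg_mem' {v} hv := by
    change torus (-v) ∈ H
    rw [torus_neg]
    exact H.inv_mem hv

theorem mem_torusLattice {H : Subgroup SU3} {v : ℤ × ℤ} : v ∈ torusLattice H ↔ torus v ∈ H :=
  Iff.rfl

/-- The exponents, in units of `1/2520`, of the eigenvalues divided by the last one. -/
def ratioExp (v : ℤ × ℤ) : Fin 3 → ℤ := ![v.1 + v.2, v.2, 0]

theorem permAct_apply (σ : Equiv.Perm (Fin 3)) (v : ℤ × ℤ) : permAct σ v =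
    (ratioExp v (σ 0) - ratioExp v (σ 1), ratioExp v (σ 1) - ratioExp v (σ 2)) := rfl

theorem torusExp_sub (v : ℤ × ℤ) (i j : Fin 3) :
    torusExp v i - torusExp v j = ((ratioExp v i - ratioExp v j : ℤ) : ℚ) / 2520 := by
  fin_cases i <;> fin_cases j <;> simp [torusExp, ratioExp] <;> ring

theorem torus_ratio (v : ℤ × ℤ) (i j : Fin 3) :
    e (torusExp v i) = e (((ratioExp v i - ratioExp v j : ℤ) : ℚ) / 2520) * e (torusExp v j) := by
  rw [← torusExp_sub, ← e_add, sub_add_cancel]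

theorem torus_smul_mem_mu3 (a b : ℤ) : torus (2520 * a, 2520 * b) ∈ mu3 := by
  refine ⟨e ((b - a) / 3), ?_, ?_⟩
  · rw [← e_nsmul]
    have : ((3 : ℕ) : ℚ) * ((b - a) / 3) = ((b - a : ℤ) : ℚ) := by push_cast; ring
    rw [this, e_int]
  · rw [coe_torus, smul_one_eq_diagonal]
    congr 1
    ext i
    rw [e_eq_iff]
    fin_cases i
    · exact ⟨a, by simp [torusExp]; ring⟩
    · exact ⟨0, by simp [torusExp]; ring⟩
    · exact ⟨-b, by simp [torusExp]; ring⟩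

/-- Exponents with the same eigenvalue ratios differ by a multiple of `2520`. -/
theorem exists_eq_add_of_ratio {v w : ℤ × ℤ} (σ : Equiv.Perm (Fin 3))
    (h : ∀ i, e (torusExp v i) = e (torusExp w (σ i))) :
    ∃ a b : ℤ, v = permAct σ w + (2520 * a, 2520 * b) := by
  have key : ∀ i j, ∃ a : ℤ,
      ratioExp v i - ratioExp v j = ratioExp w (σ i) - ratioExp w (σ j) + 2520 * a := by
    intro i j
    have h1 := h i
    rw [torus_ratio v i j, torus_ratio w (σ i) (σ j), h j] at h1
    obtain ⟨a, ha⟩ := e_eq_iff.1 (mul_right_cancel₀ (e_ne_zero _) h1)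
    refine ⟨a, ?_⟩
    field_simp at ha
    exact_mod_cast ha
  obtain ⟨a, ha⟩ := key 0 1
  obtain ⟨b, hb⟩ := key 1 2
  refine ⟨a, b, ?_⟩
  rw [permAct_apply, Prod.mk_add_mk, ← ha, ← hb]
  ext <;> simp [ratioExp]

theorem permAct_one (v : ℤ × ℤ) : permAct 1 v = v := by
  rw [permAct_apply]
  ext <;> simp [ratioExp]

theorem exists_eq_add_of_torus_eq {v w : ℤ × ℤ} (h : torus v = torus w) :
    ∃ a b : ℤ, v = w + (2520 * a, 2520 * b) := by
  have := exists_eq_add_of_ratio (v := v) (w := w) 1 fun i => ((torus_eq_iff (coe_torus v)).1 h) i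
  rwa [permAct_one] at this

/-- A diagonal matrix in `SU(3)` is determined by its eigenvalue ratios up to `μ₃`. -/
theorem exists_eq_torus {A : SU3} {d : Fin 3 → ℂ}
    (hA : (A : Matrix (Fin 3) (Fin 3) ℂ) = diagonal d) {x y : ℤ}
    (h01 : d 0 = e (x / 2520) * d 1) (h12 : d 1 = e (y / 2520) * d 2) :
    ∃ k : ℤ, A = torus (x + 2520 * k, y) := by
  have hdet : d 0 * d 1 * d 2 = 1 := by
    have := (mem_specialUnitaryGroup_iff.1 A.2).2
    rwa [hA, det_diagonal, Fin.prod_univ_three] at this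
  -- The third exponent of `torus (x, y)`; determinant 1 forces `d 2` to be `e t` up to a cube root
  -- of unity.
  set t : ℚ := -(x + 2 * y) / 7560 with ht
  have hcube : (d 2 * e (-t)) ^ 3 = 1 := by
    rw [h01, h12] at hdet
    have h3 : e (-t) ^ 3 = e (x / 2520) * e (y / 2520) * e (y / 2520) := by
      rw [← e_nsmul, ← e_add, ← e_add]
      congr 1
      rw [ht]
      push_cast
      ring
    rw [mul_pow, h3]
    linear_combination hdet
  obtain ⟨k, hk⟩ := exists_e_eq_of_pow_eq_one (by norm_num) hcube
  have h2 : d 2 = e (k / 3 + t) := by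
    rw [e_add]
    have : e (k / (3 : ℕ)) * e t = d 2 := by
      rw [← hk, mul_assoc, ← e_add, neg_add_cancel, e_zero, mul_one]
    exact_mod_cast this.symm
  have h1 : d 1 = e (y / 2520 + (k / 3 + t)) := by rw [h12, h2, ← e_add]
  have h0 : d 0 = e (x / 2520 + (y / 2520 + (k / 3 + t))) := by rw [h01, h1, ← e_add]
  -- `torus (2520 * j, 0)` is the scalar `e(-j/3)`, so `j = -k` supplies the factor `e(k/3)`.
  refine ⟨-k, (torus_eq_iff hA).2 fun i => ?_⟩
  fin_cases i
  · refine h0.trans (e_eq_iff.2 ⟨k, ?_⟩)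
    simp [torusExp, ht]
    ring
  · refine h1.trans (e_eq_iff.2 ⟨0, ?_⟩)
    simp [torusExp, ht]
    ring
  · refine h2.trans (e_eq_iff.2 ⟨0, ?_⟩)
    simp [torusExp, ht]
    ring

/-- The hypotheses on `x` and `y` come from replacing `u` by `-v - w`, to which it is congruent
modulo 1. -/
theorem D_eq_torus {u v w : ℚ} (h : ∃ n : ℤ, u + v + w = n) {x y : ℤ}
    (hx : (x : ℚ) = -2520 * (2 * v + w)) (hy : (y : ℚ) = 2520 * (v - w)) :
    D u v w h = torus (x, y) := by
  rw [torus_eq_iff (d := ![e u, e v, e w]) rfl]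
  obtain ⟨n, hn⟩ := h
  intro i
  fin_cases i
  · refine e_eq_iff.2 ⟨n, ?_⟩
    simp [torusExp, hx, hy, ← hn]
    ring
  · refine e_eq_iff.2 ⟨0, ?_⟩
    simp [torusExp, hx, hy]
    ring
  · refine e_eq_iff.2 ⟨0, ?_⟩
    simp [torusExp, hx, hy]
    ring

theorem abelianGroup_eq_closure (l : AbelianLabel) :
    abelianGroup l = Subgroup.closure {A | ∃ v ∈ latticeGens l, A = torus v} := by
  cases l <;> simp only [abelianGroup, latticeGens] <;> congr 1 <;> ext A <;>
    simp only [List.mem_cons, List.not_mem_nil, or_false, exists_eq_or_imp, exists_eq_left,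
      Set.mem_singleton_iff, Set.mem_insert_iff, Set.mem_ofPred_eq] <;>
    first
    | (rw [D_eq_torus]; all_goals norm_num; done)
    | (rw [D_eq_torus, D_eq_torus]; all_goals norm_num)

end FiniteSU3

/-! ### The listed groups, their lattices and conjugation by permutations -/

namespace FiniteSU3

open Matrix

theorem latticeGens_subset (l : AbelianLabel) {v : ℤ × ℤ} (hv : v ∈ latticeGens l) :
    v ∈ lattice l := by
  have hcheck : ∀ v ∈ latticeGens l,
      v.1 = v.1 / (latticeBasis l).1 * (latticeBasis l).1 ∧
      v.2 = v.1 / (latticeBasis l).1 * (latticeBasis l).2.1 +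
        (v.2 - v.1 / (latticeBasis l).1 * (latticeBasis l).2.1) / (latticeBasis l).2.2 *
          (latticeBasis l).2.2 := by
    cases l <;> decide
  obtain ⟨h1, h2⟩ := hcheck v hv
  exact mem_lattice_iff.2 ⟨_, _, h1, h2⟩

/-- `torus` is not injective, so the basis of a lattice is expressed through the group generators
together with these kernel vectors. -/
theorem torus_relation (v : ℤ × ℤ) (hv : v ∈ [((2520 : ℤ), (2520 : ℤ)), (7560, 0)]) :
    torus v = 1 := by
  symm
  rw [torus_eq_iff (d := 1) diagonal_one.symm]
  intro i
  symm
  rw [Pi.one_apply, e_eq_one_iff]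
  simp only [List.mem_cons, List.not_mem_nil, or_false] at hv
  rcases hv with rfl | rfl <;> fin_cases i
  · exact ⟨1, by norm_num [torusExp]⟩
  · exact ⟨0, by norm_num [torusExp]⟩
  · exact ⟨-1, by norm_num [torusExp]⟩
  · exact ⟨2, by norm_num [torusExp]⟩
  · exact ⟨-1, by norm_num [torusExp]⟩
  · exact ⟨-1, by norm_num [torusExp]⟩

/-- The integral combination of the generators and the relations with given coefficients. -/
def latticeComb (l : AbelianLabel) (c : List ℤ) : ℤ × ℤ :=
  ((c.zip (latticeGens l ++ [(2520, 2520), (7560, 0)])).map fun p => p.1 • p.2).sum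

theorem lattice_le_torusLattice (l : AbelianLabel) :
    lattice l ≤ torusLattice (abelianGroup l) := by
  have hgen : ∀ v ∈ latticeGens l ++ [((2520 : ℤ), (2520 : ℤ)), (7560, 0)],
      v ∈ torusLattice (abelianGroup l) := by
    intro v hv
    rw [mem_torusLattice]
    rcases List.mem_append.1 hv with h | h
    · rw [abelianGroup_eq_closure]
      exact Subgroup.subset_closure ⟨v, h, rfl⟩
    · rw [torus_relation v h]
      exact Subgroup.one_mem _
  have hcomb : ∀ c, latticeComb l c ∈ torusLattice (abelianGroup l) := by
    intro c
    refine list_sum_mem fun w hw => ?_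
    obtain ⟨p, hp, rfl⟩ := List.mem_map.1 hw
    exact AddSubgroup.zsmul_mem _ (hgen _ (List.of_mem_zip hp).2) _
  have h : ∀ w ∈ latticeVec l, ((w.1 : ℤ), (w.2 : ℤ)) = latticeComb l (latticeCoeffs l).1 ∨
      ((w.1 : ℤ), (w.2 : ℤ)) = latticeComb l (latticeCoeffs l).2 := by
    cases l <;> decide
  rw [lattice, AddSubgroup.closure_le]
  rintro _ ⟨w, hw, rfl⟩
  rcases h w hw with h | h <;> rw [h] <;> exact hcomb _

theorem mem_abelianGroup_iff {l : AbelianLabel} {A : SU3} :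
    A ∈ abelianGroup l ↔ ∃ v ∈ lattice l, torus v = A := by
  constructor
  · intro hA
    rw [abelianGroup_eq_closure] at hA
    induction hA using Subgroup.closure_induction with
    | mem A hA =>
      obtain ⟨v, hv, rfl⟩ := hA
      exact ⟨v, latticeGens_subset l hv, rfl⟩
    | one => exact ⟨0, (lattice l).zero_mem, torus_zero⟩
    | mul A B _ _ hA hB =>
      obtain ⟨v, hv, rfl⟩ := hA
      obtain ⟨w, hw, rfl⟩ := hB
      exact ⟨v + w, (lattice l).add_mem hv hw, torus_add v w⟩
    | inv A _ hA =>
      obtain ⟨v, hv, rfl⟩ := hA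
      exact ⟨-v, (lattice l).neg_mem hv, torus_neg v⟩
  · rintro ⟨v, hv, rfl⟩
    exact lattice_le_torusLattice l hv

theorem torus_mem_abelianGroup_iff {l : AbelianLabel} {v : ℤ × ℤ} :
    torus v ∈ abelianGroup l ↔ v ∈ lattice l := by
  rw [mem_abelianGroup_iff]
  constructor
  · rintro ⟨w, hw, h⟩
    obtain ⟨a, b, rfl⟩ := exists_eq_add_of_torus_eq h.symm
    exact (lattice l).add_mem hw (smul_mem_lattice l a b)
  · exact fun hv => ⟨v, hv, rfl⟩

theorem Conjugate.symm {H K : Subgroup SU3} (h : Conjugate H K) : Conjugate K H := by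
  obtain ⟨g, rfl⟩ := h
  refine ⟨g⁻¹, ?_⟩
  rw [Subgroup.map_map]
  convert! Subgroup.map_id H
  ext A : 1
  simp [mul_assoc]

theorem Conjugate.trans {H K L : Subgroup SU3} (h : Conjugate H K) (h' : Conjugate K L) :
    Conjugate H L := by
  obtain ⟨g, rfl⟩ := h
  obtain ⟨g', rfl⟩ := h'
  refine ⟨g' * g, ?_⟩
  rw [Subgroup.map_map]
  congr 1
  ext A : 1
  simp [mul_assoc]

/-- Matrices which conjugate diagonal matrices to diagonal matrices permute their entries. -/
theorem exists_perm_of_conj_diagonal (g : SU3) : ∃ σ : Equiv.Perm (Fin 3),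
    ∀ v w : ℤ × ℤ, g * torus v * g⁻¹ = torus w →
      ∀ i, e (torusExp w i) = e (torusExp v (σ i)) := by
  have hdet : (g : Matrix (Fin 3) (Fin 3) ℂ)ᵀ.det ≠ 0 := by
    rw [det_transpose, (mem_specialUnitaryGroup_iff.1 g.2).2]
    exact one_ne_zero
  -- A nonzero term of the determinant gives one `σ` with every entry `g i (σ i)` nonzero. Comparing
  -- these entries in `g * torus v = torus w * g` matches the eigenvalues, for all `v` and `w` at
  -- once.
  rw [det_apply] at hdet
  obtain ⟨σ, -, hσ⟩ := Finset.exists_ne_zero_of_sum_ne_zero hdet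
  refine ⟨σ, fun v w h i => ?_⟩
  have hent : (g : Matrix (Fin 3) (Fin 3) ℂ) i (σ i) ≠ 0 := by
    intro h0
    apply hσ
    rw [Finset.prod_eq_zero (Finset.mem_univ i) (by simpa using h0), smul_zero]
  rw [mul_inv_eq_iff_eq_mul] at h
  have h' := congrArg (fun A : SU3 => (A : Matrix (Fin 3) (Fin 3) ℂ) i (σ i)) h
  simp only [Submonoid.coe_mul, coe_torus, mul_diagonal, diagonal_mul] at h'
  rw [mul_comm] at h'
  exact (mul_right_cancel₀ hent h').symm

theorem exists_lattice_le_of_conjugate {l l' : AbelianLabel}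
    (h : Conjugate (abelianGroup l) (abelianGroup l')) :
    ∃ σ, lattice l ≤ (lattice l').comap (permAct σ) := by
  obtain ⟨g, hg⟩ := h
  obtain ⟨σ, hσ⟩ := exists_perm_of_conj_diagonal g
  refine ⟨σ, fun v hv => ?_⟩
  have hmem : g * torus v * g⁻¹ ∈ abelianGroup l' := by
    rw [← hg]
    exact ⟨torus v, torus_mem_abelianGroup_iff.2 hv, rfl⟩
  obtain ⟨w, hw, hvw⟩ := mem_abelianGroup_iff.1 hmem
  obtain ⟨a, b, rfl⟩ := exists_eq_add_of_ratio σ (hσ v w hvw.symm)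
  exact (AddSubgroup.add_mem_cancel_right _ (smul_mem_lattice l' a b)).1 hw

theorem eq_of_conjugate {l l' : AbelianLabel}
    (h : Conjugate (abelianGroup l) (abelianGroup l')) : l = l' := by
  obtain ⟨σ, hσ⟩ := exists_lattice_le_of_conjugate h
  obtain ⟨τ, hτ⟩ := exists_lattice_le_of_conjugate h.symm
  exact eq_of_lattice_le_comap hσ hτ

/-- A permutation matrix with determinant normalised to `1`. -/
theorem exists_perm_conj (σ : Equiv.Perm (Fin 3)) : ∃ g : SU3,
    ∀ (A : SU3) (d : Fin 3 → ℂ), (A : Matrix (Fin 3) (Fin 3) ℂ) = diagonal d →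
      ((g * A * g⁻¹ : SU3) : Matrix (Fin 3) (Fin 3) ℂ) = diagonal (d ∘ σ) := by
  set P : Matrix (Fin 3) (Fin 3) ℂ := σ.permMatrix ℂ with hP
  have hunit : P ∈ unitaryGroup (Fin 3) ℂ := by
    rw [mem_unitaryGroup_iff, star_eq_conjTranspose, hP, conjTranspose_permMatrix,
      ← permMatrix_mul]
    simp
  obtain ⟨g, c, hg⟩ := exists_smul_mem_SU3 hunit
  refine ⟨g, fun A d hA => ?_⟩
  have hgg : (g : Matrix (Fin 3) (Fin 3) ℂ) * ((g⁻¹ : SU3) : Matrix (Fin 3) (Fin 3) ℂ) = 1 := by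
    rw [← Submonoid.coe_mul, mul_inv_cancel]
    rfl
  have hcomm : (g : Matrix (Fin 3) (Fin 3) ℂ) * A = diagonal (d ∘ σ) * g := by
    rw [hg, hA, smul_mul_assoc, mul_smul_comm]
    congr 1
    ext i j
    rw [mul_diagonal, diagonal_mul, hP]
    simp only [Equiv.Perm.permMatrix, PEquiv.toMatrix_apply, Equiv.toPEquiv_apply, Option.mem_def,
      Option.some.injEq, Function.comp_apply]
    split_ifs with h
    · rw [h]; ring
    · ring
  rw [Submonoid.coe_mul, Submonoid.coe_mul, hcomm, mul_assoc, hgg, mul_one]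

/-- Eigenvalue ratios fix a matrix only up to `μ₃`, whence the shift by `(2520 * k, 0)`. The second
clause keeps a group diagonal when it is conjugated by `g⁻¹`. -/
theorem exists_conj_torus (σ : Equiv.Perm (Fin 3)) : ∃ g : SU3,
    (∀ v, ∃ k : ℤ, g * torus v * g⁻¹ = torus (permAct σ v + (2520 * k, 0))) ∧
    ∀ (A : SU3) (d : Fin 3 → ℂ), (A : Matrix (Fin 3) (Fin 3) ℂ) = diagonal d →
      ∃ d', ((g⁻¹ * A * g : SU3) : Matrix (Fin 3) (Fin 3) ℂ) = diagonal d' := by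
  obtain ⟨g, hg⟩ := exists_perm_conj σ
  obtain ⟨h, hh⟩ := exists_perm_conj σ⁻¹
  refine ⟨g, fun v => ?_, fun A d hA => ⟨d ∘ ⇑σ⁻¹, ?_⟩⟩
  · have h1 := hg (torus v) _ (coe_torus v)
    obtain ⟨k, hk⟩ := exists_eq_torus h1 (x := (permAct σ v).1) (y := (permAct σ v).2)
      (torus_ratio v (σ 0) (σ 1)) (torus_ratio v (σ 1) (σ 2))
    exact ⟨k, by rw [hk]; congr 1; ext <;> simp⟩
  · have h1 := hh A d hA
    have h2 := hg (h * A * h⁻¹) _ h1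
    -- The permutations `σ⁻¹` and `σ` cancel on diagonal matrices, so conjugation by `h` agrees with
    -- conjugation by `g⁻¹` on `A`.
    have h3 : g * (h * A * h⁻¹) * g⁻¹ = A := by
      apply Subtype.ext
      rw [h2, hA, Function.comp_assoc]
      congr 1
      ext i
      simp
    rw [← h1]
    congr 1
    conv_lhs => rw [← h3]
    group

end FiniteSU3

/-! ### Restricted rationality and the climb through the lattices -/

namespace FiniteSU3

open Matrix

theorem mu3_comm {A : SU3} (hA : A ∈ mu3) (B : SU3) : A * B = B * A := by
  obtain ⟨z, -, hz⟩ := hA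
  apply Subtype.ext
  rw [Submonoid.coe_mul, Submonoid.coe_mul, hz, smul_one_mul, mul_smul_one]

/-- The finite groups of diagonal matrices under consideration. -/
structure IsRationalTorus (H : Subgroup SU3) : Prop where
  finite : (H : Set SU3).Finite
  mu3_le : mu3 ≤ H
  rational : RestrictedRationality H
  diag : ∀ A ∈ H, ∃ d, (A : Matrix (Fin 3) (Fin 3) ℂ) = diagonal d

theorem IsRationalTorus.of_conj {H : Subgroup SU3} (hfin : (H : Set SU3).Finite)
    (hmu : mu3 ≤ H) (hrat : RestrictedRationality H) (g : SU3)
    (hd : ∀ A ∈ H, ∃ d, ((g * A * g⁻¹ : SU3) : Matrix (Fin 3) (Fin 3) ℂ) = diagonal d) :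
    IsRationalTorus (H.map (MulAut.conj g).toMonoidHom) where
  finite := by
    rw [Subgroup.coe_map]
    exact hfin.image _
  mu3_le A hA := ⟨A, hmu hA, by
    change g * A * g⁻¹ = A
    rw [← mu3_comm hA, mul_inv_cancel_right]⟩
  rational := by
    rintro _ ⟨A, hA, rfl⟩
    obtain ⟨n, hn⟩ := hrat A hA
    refine ⟨n, ?_⟩
    rw [← hn]
    congr 2
    change ((g * A * g⁻¹ : SU3) : Matrix (Fin 3) (Fin 3) ℂ).trace = _
    rw [Submonoid.coe_mul, trace_mul_comm, ← Submonoid.coe_mul, ← mul_assoc, inv_mul_cancel,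
      one_mul]
  diag := by
    rintro _ ⟨A, hA, rfl⟩
    exact hd A hA

/-- The nontrivial eigenvalues of a diagonal matrix acting by conjugation. -/
noncomputable def rootValues (d : Fin 3 → ℂ) : Multiset ℂ :=
  {d 0 / d 1, d 1 / d 0, d 1 / d 2, d 2 / d 1, d 0 / d 2, d 2 / d 0}

theorem norm_eq_one_of_diagonal {A : SU3} {d : Fin 3 → ℂ}
    (hA : (A : Matrix (Fin 3) (Fin 3) ℂ) = diagonal d) (i : Fin 3) : ‖d i‖ = 1 := by
  have h := mem_unitaryGroup_iff.1 (mem_specialUnitaryGroup_iff.1 A.2).1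
  rw [hA, star_eq_conjTranspose, diagonal_conjTranspose, diagonal_mul_diagonal] at h
  have h2 : d i * star (d i) = 1 := by
    have := congrFun (congrFun h i) i
    simpa using this
  rw [Complex.star_def, Complex.mul_conj, Complex.normSq_eq_norm_sq] at h2
  have h3 : ‖d i‖ ^ 2 = 1 := by exact_mod_cast h2
  exact (pow_eq_one_iff_of_nonneg (norm_nonneg _) (by norm_num)).1 h3

/-- Eigenvalues have modulus 1, so conjugates are inverses; in the expansion of trace times its
conjugate the three diagonal terms give 3. -/
theorem norm_trace_sq {A : SU3} {d : Fin 3 → ℂ}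
    (hA : (A : Matrix (Fin 3) (Fin 3) ℂ) = diagonal d) :
    ((‖(A : Matrix (Fin 3) (Fin 3) ℂ).trace‖ ^ 2 : ℝ) : ℂ) = 3 + (rootValues d).sum := by
  have h := norm_eq_one_of_diagonal hA
  have h0 : ∀ i, d i ≠ 0 := fun i hi => by simpa [hi] using h i
  have hstar : ∀ i, star (d i) = (d i)⁻¹ := fun i => (Complex.inv_eq_conj (h i)).symm
  rw [← Complex.normSq_eq_norm_sq, ← Complex.mul_conj, ← Complex.star_def, hA, trace_diagonal,
    Fin.sum_univ_three, star_add, star_add, hstar, hstar, hstar, rootValues]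
  have h00 := h0 0
  have h01 := h0 1
  have h02 := h0 2
  simp only [Multiset.insert_eq_cons, Multiset.sum_cons, Multiset.sum_singleton]
  field_simp
  ring

/-- The `k`-th powers of the ratios of `A` are the ratios of `A ^ k`, which is again in `H`. -/
theorem IsRationalTorus.sum_rootValues_pow {H : Subgroup SU3} (hH : IsRationalTorus H) {A : SU3}
    (hAH : A ∈ H) {d : Fin 3 → ℂ} (hA : (A : Matrix (Fin 3) (Fin 3) ℂ) = diagonal d) (k : ℕ) :
    ∃ n : ℤ, ((rootValues d).map (· ^ k)).sum = n := by
  obtain ⟨n, hn⟩ := hH.rational (A ^ k) (H.pow_mem hAH k)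
  have hAk : ((A ^ k : SU3) : Matrix (Fin 3) (Fin 3) ℂ) = diagonal (d ^ k) := by
    rw [SubmonoidClass.coe_pow, hA, diagonal_pow]
  have h := norm_trace_sq hAk
  rw [hn] at h
  refine ⟨n - 3, ?_⟩
  have hmap : (rootValues d).map (· ^ k) = rootValues (d ^ k) := by
    simp [rootValues, div_pow]
  rw [hmap]
  push_cast at h ⊢
  linear_combination -h

theorem rootValues_pow {A : SU3} {d : Fin 3 → ℂ}
    (hA : (A : Matrix (Fin 3) (Fin 3) ℂ) = diagonal d) {N : ℕ} (hN : A ^ N = 1) {z : ℂ}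
    (hz : z ∈ rootValues d) : z ^ N = 1 := by
  have hd : ∀ i, d i ^ N = 1 := by
    intro i
    have := congrArg (fun B : SU3 => (B : Matrix (Fin 3) (Fin 3) ℂ) i i) hN
    simp only [SubmonoidClass.coe_pow, hA, diagonal_pow, diagonal_apply_eq] at this
    simpa using this
  simp only [rootValues, Multiset.insert_eq_cons, Multiset.mem_cons, Multiset.mem_singleton] at hz
  rcases hz with rfl | rfl | rfl | rfl | rfl | rfl <;> simp [div_pow, hd]

theorem IsRationalTorus.totient_le {H : Subgroup SU3} (hH : IsRationalTorus H) {A : SU3}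
    (hAH : A ∈ H) {d : Fin 3 → ℂ} (hA : (A : Matrix (Fin 3) (Fin 3) ℂ) = diagonal d) {z : ℂ}
    (hz : z ∈ rootValues d) : 0 < orderOf z ∧ (orderOf z).totient ≤ 6 := by
  have : Finite H := hH.finite
  obtain ⟨N, hN, hAN⟩ := isOfFinOrder_iff_pow_eq_one.1 (isOfFinOrder_of_finite (⟨A, hAH⟩ : H))
  have hAN' : A ^ N = 1 := congrArg Subtype.val hAN
  refine ⟨orderOf_pos_iff.2 (isOfFinOrder_iff_pow_eq_one.2 ⟨N, hN, rootValues_pow hA hAN' hz⟩), ?_⟩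
  exact Nat.totient_orderOf_le_card_of_sum_map_pow_int hN (rootValues d)
    (fun w hw => rootValues_pow hA hAN' hw) (hH.sum_rootValues_pow hAH hA) hz

theorem IsRationalTorus.exists_torus {H : Subgroup SU3} (hH : IsRationalTorus H) {A : SU3}
    (hAH : A ∈ H) : ∃ v, A = torus v := by
  obtain ⟨d, hA⟩ := hH.diag A hAH
  have hd : ∀ i, d i ≠ 0 := fun i hi => by simpa [hi] using norm_eq_one_of_diagonal hA i
  have key : ∀ z ∈ rootValues d, ∃ x : ℤ, z = e (x / 2520) := by
    intro z hz
    obtain ⟨hpos, hle⟩ := hH.totient_le hAH hA hz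
    have := orderOf_dvd_iff_pow_eq_one.1 (Nat.dvd_2520_of_totient_le hpos hle)
    exact_mod_cast exists_e_eq_of_pow_eq_one (by norm_num) this
  obtain ⟨x, hx⟩ := key (d 0 / d 1) (by simp [rootValues])
  obtain ⟨y, hy⟩ := key (d 1 / d 2) (by simp [rootValues])
  obtain ⟨k, hk⟩ := exists_eq_torus hA ((div_eq_iff (hd 1)).1 hx) ((div_eq_iff (hd 2)).1 hy)
  exact ⟨_, hk⟩

theorem dvd_of_totient_le {n : ℕ} (hn : n ∣ 2520) (h : n.totient ≤ 6) :
    ∃ m ∈ [8, 10, 12, 14, 18], n ∣ m := by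
  have : ∀ n ∈ List.range 2521, 2520 % n ≠ 0 ∨ 6 < n.totient ∨
      ∃ m ∈ [8, 10, 12, 14, 18], n ∣ m := by decide +kernel
  rcases this n (List.mem_range.2 (Nat.lt_succ_of_le (Nat.le_of_dvd (by norm_num) hn)))
    with h1 | h1 | h1
  · exact absurd (Nat.mod_eq_zero_of_dvd hn) h1
  · omega
  · exact h1

theorem e_div_eq_stdAddChar (x : ℤ) : e (x / 2520) = ZMod.stdAddChar (x : ZMod 2520) := by
  rw [ZMod.stdAddChar_coe, e]
  push_cast
  ring_nf

/-- The exponents of `rootValues`, in units of `1/2520`. -/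
def rootResidues (a b : ZMod 2520) : Multiset (ZMod 2520) :=
  {a, -a, b, -b, a + b, -(a + b)}

theorem rootValues_torus (v : ℤ × ℤ) : rootValues (fun i => e (torusExp v i)) =
    (rootResidues v.1 v.2).map ZMod.stdAddChar := by
  have key : ∀ i j, e (torusExp v i) / e (torusExp v j) =
      ZMod.stdAddChar ((ratioExp v i - ratioExp v j : ℤ) : ZMod 2520) := by
    intro i j
    rw [torus_ratio v i j, mul_div_cancel_right₀ _ (e_ne_zero _), e_div_eq_stdAddChar]
  simp only [rootValues, key]
  simp [ratioExp, rootResidues]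

/-- The weight of a residue class modulo `2520`. -/
def residueWeight (z : ZMod 2520) : ℕ := weight z.val

theorem residueWeight_natCast (x : ℕ) : residueWeight (x : ZMod 2520) = weight x := by
  simp [residueWeight, weight, ZMod.val_natCast]

theorem residueWeight_neg (z : ZMod 2520) : residueWeight (-z) = residueWeight z := by
  rw [residueWeight, residueWeight, ZMod.neg_val]
  have hlt := ZMod.val_lt z
  split_ifs with h
  · rw [h, ZMod.val_zero]
  · have hpos : 0 < z.val := Nat.pos_of_ne_zero fun h0 => h ((ZMod.val_eq_zero z).1 h0)
    rw [weight, weight, Nat.mod_eq_of_lt hlt, Nat.mod_eq_of_lt (by omega),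
      Nat.sub_sub_self hlt.le, mul_comm]

/-- The totient bound gives the two order conditions, and stability of the six ratios under `z ↦ z ^
67` gives the equality of weights. -/
theorem IsRationalTorus.admissible {H : Subgroup SU3} (hH : IsRationalTorus H) {x y : ℕ}
    (h : ((x : ℤ), (y : ℤ)) ∈ torusLattice H) : admissible x y = true := by
  have hA := coe_torus ((x : ℤ), (y : ℤ))
  have hroots := rootValues_torus ((x : ℤ), (y : ℤ))
  set M := rootValues fun i => e (torusExp ((x : ℤ), (y : ℤ)) i) with hM
  simp only [Int.cast_natCast] at hroots
  have hpow : ∀ z ∈ M, z ^ 2520 = 1 := by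
    intro z hz
    rw [hroots, Multiset.mem_map] at hz
    obtain ⟨w, -, rfl⟩ := hz
    rw [← AddChar.map_nsmul_eq_pow]
    have : (2520 : ℕ) • w = 0 := by
      rw [nsmul_eq_mul, ZMod.natCast_self, zero_mul]
    rw [this, AddChar.map_zero_eq_one]
  have hsmall : ∀ w : ℕ, ZMod.stdAddChar (w : ZMod 2520) ∈ M → smallOrder w = true := by
    intro w hw
    obtain ⟨hpos, hle⟩ := hH.totient_le h hA hw
    obtain ⟨m, hm, hdvd⟩ := dvd_of_totient_le (Nat.dvd_2520_of_totient_le hpos hle) hle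
    refine List.any_eq_true.2 ⟨m, hm, ?_⟩
    have h1 := orderOf_dvd_iff_pow_eq_one.1 hdvd
    rw [← AddChar.map_nsmul_eq_pow, ← AddChar.map_zero_eq_one (ZMod.stdAddChar (N := 2520))] at h1
    have h2 := ZMod.injective_stdAddChar h1
    rw [nsmul_eq_mul, ← Nat.cast_mul, ZMod.natCast_eq_zero_iff] at h2
    rw [Nat.beq_eq]
    exact Nat.mod_eq_zero_of_dvd h2
  have hinv := Multiset.map_pow_eq_self_of_sum_map_pow_int (u := 67) (by norm_num) (by norm_num)
    M hpow (hH.sum_rootValues_pow h hA)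
  have hx := hsmall x (by rw [hroots]; exact Multiset.mem_map_of_mem _ (by simp [rootResidues]))
  have hy := hsmall y (by rw [hroots]; exact Multiset.mem_map_of_mem _ (by simp [rootResidues]))
  rw [hroots, Multiset.map_map] at hinv
  have hinv' := Multiset.map_injective (ZMod.injective_stdAddChar (N := 2520))
    ((Multiset.map_map _ _ _).trans (Eq.trans (Multiset.map_congr rfl fun z _ =>
      AddChar.map_nsmul_eq_pow (ZMod.stdAddChar (N := 2520)) 67 z) hinv))
  -- The six residues come in pairs `±a` of equal weight, so this equality is twice the one in
  -- `admissible`.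
  have hsum := congrArg (fun S : Multiset (ZMod 2520) => (S.map residueWeight).sum) hinv'
  have h67 : ∀ w : ZMod 2520, 67 • w = ((67 : ℕ) : ZMod 2520) * w := fun w => nsmul_eq_mul _ _
  simp only [rootResidues, Multiset.insert_eq_cons, Multiset.map_cons, Multiset.map_singleton,
    Multiset.sum_cons, Multiset.sum_singleton, mul_neg, residueWeight_neg, h67] at hsum
  rw [← Nat.cast_add] at hsum
  simp only [← Nat.cast_mul, residueWeight_natCast] at hsum
  simp only [FiniteSU3.admissible, hx, hy, Bool.true_and, Nat.beq_eq]
  omega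

theorem IsRationalTorus.exists_conjugate {H : Subgroup SU3} (hH : IsRationalTorus H)
    (l : AbelianLabel) (hl : lattice l ≤ torusLattice H) :
    ∃ l', Conjugate H (abelianGroup l') := by
  -- 36 is the largest lattice size, attained by `A(6,6φ)`; each climb lowers this difference.
  obtain ⟨n, hn⟩ : ∃ n, 36 - latticeSize l = n := ⟨_, rfl⟩
  induction n using Nat.strong_induction_on generalizing H l with
  | _ n ih =>
    by_cases hle : torusLattice H ≤ lattice l
    · refine ⟨l, 1, ?_⟩
      have : H = abelianGroup l := by
        ext A
        rw [mem_abelianGroup_iff]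
        constructor
        · intro hA
          obtain ⟨v, rfl⟩ := hH.exists_torus hA
          exact ⟨v, hle hA, rfl⟩
        · rintro ⟨v, hv, rfl⟩
          exact hl hv
      rw [← this, map_one]
      exact Subgroup.map_id H
    · obtain ⟨l', hlt, σ, hσ⟩ := exists_larger_lattice (fun x y h => hH.admissible h) hl hle
      obtain ⟨g, hg, hgd⟩ := exists_conj_torus σ
      -- Conjugating by `g⁻¹` undoes the permutation, so the conjugate of `H` contains `lattice l'`
      -- itself and the induction applies to it.
      have hH' : IsRationalTorus (H.map (MulAut.conj g⁻¹).toMonoidHom) := by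
        refine .of_conj hH.finite hH.mu3_le hH.rational g⁻¹ fun A hA => ?_
        obtain ⟨d, hd⟩ := hH.diag A hA
        rw [inv_inv]
        exact hgd A d hd
      have hl' : lattice l' ≤ torusLattice (H.map (MulAut.conj g⁻¹).toMonoidHom) := by
        intro v hv
        obtain ⟨k, hk⟩ := hg v
        refine ⟨g * torus v * g⁻¹, ?_, ?_⟩
        · rw [hk]
          have h2 := hl (smul_mem_lattice l k 0)
          rw [mul_zero] at h2
          exact (torusLattice H).add_mem (hσ hv) h2
        · change g⁻¹ * (g * torus v * g⁻¹) * g⁻¹⁻¹ = torus v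
          group
      have hsize : ∀ l, latticeSize l ≤ 36 := by
        intro l
        cases l <;> decide
      have := hsize l'
      obtain ⟨l'', h''⟩ := ih (36 - latticeSize l') (by omega) hH' l' hl' rfl
      exact ⟨l'', Conjugate.trans ⟨g⁻¹, rfl⟩ h''⟩

theorem lattice_A_1_1_le {H : Subgroup SU3} (hmu : mu3 ≤ H) :
    lattice .A_1_1 ≤ torusLattice H := by
  intro v hv
  obtain ⟨m, n, h1, h2⟩ := mem_lattice_iff.1 hv
  have : v = (2520 * m, 2520 * n) := by
    ext
    · simp [h1, latticeBasis, mul_comm]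
    · simp [h2, latticeBasis, mul_comm]
  rw [this]
  exact hmu (torus_smul_mem_mu3 m n)

end FiniteSU3

theorem mainTheorem4 (H : Subgroup FiniteSU3.SU3)
    (hfin : (H : Set FiniteSU3.SU3).Finite)
    (hmu : FiniteSU3.mu3 ≤ H)
    (hrat : FiniteSU3.RestrictedRationality H)
    (hab : ∀ A ∈ H, ∀ B ∈ H, A * B = B * A) :
    ∃! l : FiniteSU3.AbelianLabel, FiniteSU3.Conjugate H (FiniteSU3.abelianGroup l) := by
  obtain ⟨g, hg⟩ := FiniteSU3.exists_conj_isDiag H hab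
  have hH := FiniteSU3.IsRationalTorus.of_conj hfin hmu hrat g hg
  obtain ⟨l, hl⟩ := hH.exists_conjugate .A_1_1 (FiniteSU3.lattice_A_1_1_le hH.mu3_le)
  have hconj := FiniteSU3.Conjugate.trans ⟨g, rfl⟩ hl
  exact ⟨l, hconj, fun l' hl' => FiniteSU3.eq_of_conjugate (hl'.symm.trans hconj)⟩
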